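/- Let $d\in\mathbb N$ and $E=\{1,\dots,d\}$. Write $\langle\cdot,\cdot\rangle$ and $\|\cdot\|$ for the Euclidean inner product and norm, $e_1,\dots,e_d$ for the standard basis, and $x(i)=x_i$. Let $c_i\ge 0$, let $\widetilde B$ be a real $d\times d$ matrix with $\widetilde B_{ij}\ge 0$ for $i\ne j$, and let $\mu_i$ ($i\in E$) be measures on $\mathbb R_+^d\setminus\{0\}$ with $\int\big(\|z\|\wedge\|z\|^2+\sum_{j\ne i}z_j\big)\,\mu_i(dz)<\infty$. For $u\in\mathbb R_+^d$ put $$\psi_i(u)=-\langle u,\widetilde Be_i\rangle+c_iu_i^2+\int_{\mathbb R_+^d}\big(e^{-\langle u,z\rangle}-1+u_i(z_i\wedge1)\big)\,\mu_i(dz),\qquad B_{ij}=\widetilde B_{ij}+\int_{\mathbb R_+^d}(z_i-\mathbf 1_{\{i=j\}})^+\,\mu_j(dz).$$ For $f\in\mathbb R^d_+$ let $t\mapsto v(t,f)\in\mathbb R_+^d$ be the unique locally bounded non-negative solution of $v_i(t,f)=f_i-\int_0^t\psi_i(v(s,f))\,ds$, $i\in E$. Let $(X_t)_{t\ge0}$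 with probabilities $(\mathbb P_x)_{x\in\mathbb R_+^d}$ be a multi-type continuous-state branching process with branching mechanism $\psi$, that is, a càdlàg $\mathbb R_+^d$-valued strong Markov process with $\mathbb P_x(X_0=x)=1$ and $\mathbb E_x[e^{-\langle f,X_t\rangle}]=e^{-\langle x,v(t,f)\rangle}$ for all $x,f\in\mathbb R^d_+$, $t\ge0$; let $(\mathcal F_t)$ be its natural filtration. Let $M(t)_{ij}=\mathbb E_{e_i}[\langle e_j,X_t\rangle]$, assume that for some $t_0>0$ all entries of $M(t_0)$ are positive, and let $\lambda_1\in\mathbb R$ and $\phi$ be the Perron–Frobenius eigenvalue and right eigenvector: all $\phi(i)>0$, $\sum_i\phi(i)=1$, and $M(t)\phi=e^{\lambda_1t}\phi$ for all $t\ge0$. For $x\in\mathbb R_+^d\setminus\{0\}$ let the tilted measure $\widetilde{\mathbb P}_x$ be given by $$\frac{d\widetilde{\mathbb P}_x}{d\mathbb P_x}\bigg|_{\mathcal F_t}=\frac{W_t}{\langle\phi,x\rangle},\qquad W_t=e^{-\lambda_1t}\langle\phi,X_t\rangle,\quad t\ge0.$$ Let $(\eta_t)_{t\ge0}$ with probabilities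 $(\mathbf P_i^\phi)_{i\in E}$ be a càdlàg Markov chain on $E$ with $\mathbf P^\phi_i(\eta_0=i)=1$ and infinitesimal generator $L_{ij}=\phi(i)^{-1}\big(B^T_{ij}-\mathbf 1_{\{i=j\}}\lambda_1\big)\phi(j)$, and put $\mathbf P^\phi_{\phi x}=\sum_{i\in E}\frac{\phi(i)x(i)}{\langle\phi,x\rangle}\mathbf P_i^\phi$. **Theorem 4.** For all $x\in\mathbb R^d_+\setminus\{0\}$, $f\in\mathbb R_+^d$ and $t\ge0$, $$\widetilde{\mathbb E}_x\big[e^{-\langle f,X_t\rangle}\big]=\mathbb E_x\big[e^{-\langle f,X_t\rangle}\big]\;\mathbf E^\phi_{\phi x}\bigg[\exp\Big\{-\int_0^t\Big(2c_{\eta_s}v_{\eta_s}(t-s,f)+\int_{\mathbb R_+^d}z(\eta_s)\big(1-e^{-\langle v(t-s,f),z\rangle}\big)\mu_{\eta_s}(dz)\Big)ds\Big\}\prod_{s\le t}\mathcal A^{t-s}_{\eta_{s-},\eta_s}\bigg],$$ where $$\mathcal A^s_{ij}=\mathbf 1_{\{i\ne j\}}\frac1{B^T_{ij}}\int_{\mathbb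 R^d_+}z(j)\big(e^{-\langle v(s,f),z\rangle}-1\big)\mu_i(dz)+1,\qquad i,j\in E,$$ the entry being $1$ when $i\ne j$ and $B^T_{ij}=0$, and $\eta_{0-}=\eta_0$ (the product has only finitely many factors different from $1$). -/

import Mathlib

open MeasureTheory ProbabilityTheory Filter Topology
open scoped NNReal ENNReal Matrix

noncomputable section

namespace MCSBP

/-- The Euclidean inner product `⟨u, z⟩` of two vectors of the orthant `[0,∞)^d`. -/
def pairing {d : ℕ} (u z : Fin d → ℝ≥0) : ℝ :=
  ∑ i, (u i : ℝ) * (z i : ℝ)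

/-- The Euclidean norm of a vector of the orthant `[0,∞)^d`. -/
def euclNorm {d : ℕ} (z : Fin d → ℝ≥0) : ℝ :=
  Real.sqrt (∑ i, (z i : ℝ) ^ 2)

/-- The parameters `(c, B̃, μ)` of a branching mechanism on the type space `{1, …, d}`.
The measures `μ i` live on the orthant and do not charge the origin. -/
structure BranchingMechanism (d : ℕ) where
  /-- the diffusion coefficients `c_i ≥ 0` -/
  c : Fin d → ℝ≥0
  /-- the matrix `B̃` -/
  Btilde : Matrix (Fin d) (Fin d) ℝ
  /-- the jump measures `μ_i` -/
  μ : Fin d → Measure (Fin d → ℝ≥0)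
  Btilde_nonneg : ∀ i j, i ≠ j → 0 ≤ Btilde i j
  μ_zero : ∀ i, μ i {0} = 0
  μ_integrable : ∀ i, Integrable
    (fun z => min (euclNorm z) (euclNorm z ^ 2) + ∑ j ∈ Finset.univ.erase i, (z j : ℝ)) (μ i)

namespace BranchingMechanism

variable {d : ℕ} (b : BranchingMechanism d)

/-- The branching mechanism
`ψ_i(u) = -⟨u, B̃ e_i⟩ + c_i u_i² + ∫ (e^{-⟨u,z⟩} - 1 + u_i (z_i ∧ 1)) μ_i(dz)`. -/
def psi (i : Fin d) (u : Fin d → ℝ≥0) : ℝ :=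
  -(∑ j, (u j : ℝ) * b.Btilde j i) + (b.c i : ℝ) * (u i : ℝ) ^ 2
    + ∫ z, (Real.exp (-pairing u z) - 1 + (u i : ℝ) * min (z i : ℝ) 1) ∂(b.μ i)

/-- The matrix `B_{ij} = B̃_{ij} + ∫ (z_i - δ_{ij})⁺ μ_j(dz)`. -/
def B : Matrix (Fin d) (Fin d) ℝ := fun i j =>
  b.Btilde i j + ∫ z, max ((z i : ℝ) - (if i = j then 1 else 0)) 0 ∂(b.μ j)

/-- `v` is the cumulant semigroup of `ψ`: for every `f` in the orthant, `t ↦ v(t, f)` is the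
locally bounded non-negative solution of
`v_i(t, f) = f_i - ∫_0^t ψ_i(v(s, f)) ds`, `i = 1, …, d`. -/
structure IsCumulant (v : ℝ≥0 → (Fin d → ℝ≥0) → (Fin d → ℝ≥0)) : Prop where
  locally_bounded : ∀ (f : Fin d → ℝ≥0) (T : ℝ≥0), ∃ K : ℝ≥0, ∀ t ≤ T, ∀ i, v t f i ≤ K
  intervalIntegrable : ∀ (f : Fin d → ℝ≥0) (i : Fin d) (t : ℝ≥0),
    IntervalIntegrable (fun s : ℝ => b.psi i (v s.toNNReal f)) volume 0 t
  equation : ∀ (f : Fin d → ℝ≥0) (i : Fin d) (t : ℝ≥0),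
    (v t f i : ℝ) = (f i : ℝ) - ∫ s in (0 : ℝ)..(t : ℝ), b.psi i (v s.toNNReal f)

/-- The matrices `A^s_{ij} = 1_{i ≠ j} (B^T_{ij})⁻¹ ∫ z(j) (e^{-⟨v(s,f),z⟩} - 1) μ_i(dz) + 1`.
If `i ≠ j` and `B^T_{ij} = 0`, then `z(j) = 0` for `μ_i`-almost every `z`, the chain never jumps
from `i` to `j`, and the entry is `1`. -/
def jumpMatrix (v : ℝ≥0 → (Fin d → ℝ≥0) → (Fin d → ℝ≥0)) (f : Fin d → ℝ≥0) (s : ℝ≥0) :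
    Matrix (Fin d) (Fin d) ℝ := fun i j =>
  (if i ≠ j then
    1 / b.Bᵀ i j * ∫ z, (z j : ℝ) * (Real.exp (-pairing (v s f) z) - 1) ∂(b.μ i)
  else 0) + 1

/-- The matrix `L_{ij} = φ(i)⁻¹ (B^T_{ij} - 1_{i = j} λ₁) φ(j)`. -/
def spineGenerator (lam : ℝ) (φ : Fin d → ℝ≥0) : Matrix (Fin d) (Fin d) ℝ := fun i j =>
  1 / (φ i : ℝ) * (b.Bᵀ i j - (if i = j then lam else 0)) * (φ j : ℝ)

end BranchingMechanism

/-- Right-continuity with left limits. -/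
def IsCadlag {S : Type*} [TopologicalSpace S] (p : ℝ≥0 → S) : Prop :=
  ∀ t, ContinuousWithinAt p (Set.Ici t) t ∧ ∃ l, Tendsto p (𝓝[<] t) (𝓝 l)

/-- `(X, (P_x))` is a multi-type continuous-state branching process with branching mechanism
`ψ` and cumulant semigroup `v`: a càdlàg strong Markov process on `[0,∞)^d`, relative to its
natural filtration, with `E_x[e^{-⟨f, X_t⟩}] = e^{-⟨x, v(t, f)⟩}`. The branching property, that
the left side is multiplicative in `x`, is contained in this formula. -/
structure IsMCSBP {d : ℕ} (b : BranchingMechanism d)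
    (v : ℝ≥0 → (Fin d → ℝ≥0) → (Fin d → ℝ≥0))
    {Ω : Type*} [MeasurableSpace Ω] (P : (Fin d → ℝ≥0) → Measure Ω)
    (X : ℝ≥0 → Ω → (Fin d → ℝ≥0)) : Prop where
  isCumulant : b.IsCumulant v
  isProbabilityMeasure : ∀ x, IsProbabilityMeasure (P x)
  stronglyMeasurable : ∀ t, StronglyMeasurable (X t)
  cadlag : ∀ ω, IsCadlag (fun t => X t ω)
  start : ∀ x, P x {ω | X 0 ω = x} = 1
  measurable_transition : ∀ (t : ℝ≥0) (C : Set (Fin d → ℝ≥0)), MeasurableSet C →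
    Measurable (fun x => P x {ω | X t ω ∈ C})
  strong_markov : ∀ (x : Fin d → ℝ≥0) (τ : Ω → WithTop ℝ≥0)
    (hτ : IsStoppingTime (Filtration.natural X stronglyMeasurable) τ) (t : ℝ≥0)
    (A : Set Ω), MeasurableSet[hτ.measurableSpace] A →
    ∀ C : Set (Fin d → ℝ≥0), MeasurableSet C →
      P x (A ∩ {ω | τ ω ≠ ⊤} ∩ {ω | X ((τ ω).untopD 0 + t) ω ∈ C})
        = ∫⁻ ω in A ∩ {ω | τ ω ≠ ⊤}, P (X ((τ ω).untopD 0) ω) {ω' | X t ω' ∈ C} ∂(P x)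
  laplace : ∀ (x f : Fin d → ℝ≥0) (t : ℝ≥0),
    ∫ ω, Real.exp (-pairing f (X t ω)) ∂(P x) = Real.exp (-pairing x (v t f))

/-- The mean matrix `M(t)_{ij} = E_{e_i}[⟨e_j, X_t⟩]`. -/
def meanMatrix {d : ℕ} {Ω : Type*} [MeasurableSpace Ω] (P : (Fin d → ℝ≥0) → Measure Ω)
    (X : ℝ≥0 → Ω → (Fin d → ℝ≥0)) (t : ℝ≥0) : Matrix (Fin d) (Fin d) ℝ := fun i j =>
  ∫ ω, (X t ω j : ℝ) ∂(P (Pi.single i 1))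

/-- The martingale `W_t = e^{-λ₁ t} ⟨φ, X_t⟩`. -/
def W {d : ℕ} {Ω : Type*} (lam : ℝ) (φ : Fin d → ℝ≥0) (X : ℝ≥0 → Ω → (Fin d → ℝ≥0))
    (t : ℝ≥0) (ω : Ω) : ℝ :=
  Real.exp (-(lam * (t : ℝ))) * pairing φ (X t ω)

/-- `lam` and `φ` are the Perron–Frobenius eigenvalue and right eigenvector of the irreducible
mean semigroup `M`: some `M(t₀)`, `t₀ > 0`, has only positive entries, `φ` has positive
coordinates of sum `1`, and `M(t) φ = e^{lam t} φ` for all `t ≥ 0`. -/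
structure IsPerronPair {d : ℕ} (M : ℝ≥0 → Matrix (Fin d) (Fin d) ℝ) (lam : ℝ)
    (φ : Fin d → ℝ≥0) : Prop where
  irreducible : ∃ t₀ : ℝ≥0, 0 < t₀ ∧ ∀ i j, 0 < M t₀ i j
  pos : ∀ i, 0 < φ i
  sum_eq_one : ∑ i, φ i = 1
  eigen : ∀ t : ℝ≥0,
    M t *ᵥ (fun i => (φ i : ℝ)) = Real.exp (lam * (t : ℝ)) • (fun i => (φ i : ℝ))

/-- `(η, (P_i))` is a (càdlàg) continuous-time Markov chain on `{1, …, d}` with infinitesimal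
generator `L`: its transition semigroup is `e^{tL}`, and `P_i(η_0 = i) = 1`. -/
structure IsMarkovChain {d : ℕ} (L : Matrix (Fin d) (Fin d) ℝ)
    {Ω : Type*} [MeasurableSpace Ω] (P : Fin d → Measure Ω) (η : ℝ≥0 → Ω → Fin d) : Prop where
  isProbabilityMeasure : ∀ i, IsProbabilityMeasure (P i)
  stronglyMeasurable : ∀ t, StronglyMeasurable (η t)
  cadlag : ∀ ω, IsCadlag (fun t => η t ω)
  start : ∀ i, P i {ω | η 0 ω = i} = 1
  markov : ∀ (i : Fin d) (s t : ℝ≥0) (A : Set Ω),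
    MeasurableSet[Filtration.natural η stronglyMeasurable s] A → ∀ j k : Fin d,
      P i (A ∩ {ω | η s ω = j} ∩ {ω | η (s + t) ω = k})
        = P i (A ∩ {ω | η s ω = j}) * ENNReal.ofReal (NormedSpace.exp ((t : ℝ) • L) j k)

/-- The law `∑_i (φ(i) x(i) / ⟨φ, x⟩) P_i` of the chain started from `φ ∘ x / ⟨φ, x⟩`. -/
def spineLaw {d : ℕ} {Ω : Type*} [MeasurableSpace Ω] (P : Fin d → Measure Ω)
    (φ x : Fin d → ℝ≥0) : Measure Ω :=
  ∑ i, ENNReal.ofReal ((φ i : ℝ) * (x i : ℝ) / pairing φ x) • P i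

end MCSBP

end

/-!
The spine formula rests on two descriptions of one linear system of differential equations.

*The process.* By the density of the tilted measure, the left side is
`e^{-λ₁ t} ⟨φ, x⟩⁻¹ E_x[⟨φ, X_t⟩ e^{-⟨f, X_t⟩}]`, and the expectation is minus the derivative at
`ε = 0` of `E_x[e^{-⟨f + ε φ, X_t⟩}] = e^{-⟨x, v(t, f + ε φ)⟩}`. Hence it equals
`e^{-⟨x, v(t, f)⟩} ⟨x, w(t)⟩`, where `w(t)` is the derivative of `v(t, f)` in direction `φ`
(`IsMCSBP.integral_exp_mul_pairing`). The existence of `w` comes from the process: the difference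
quotients of `v` are bounded by Grönwall's inequality (`BranchingMechanism.IsCumulant.abs_sub_le`),
so Fatou's lemma gives the integrability of `⟨φ, X_t⟩ e^{-⟨f, X_t⟩}`, and dominated convergence the
limit. Only one-sided derivatives on the closed orthant occur, so `f` may have vanishing
coordinates. Linearizing the equation of `v` shows that `w` solves `w' = -Dψ(v) w`, `w(0) = φ`
(`IsMCSBP.cumulantDeriv_eq`).

*The chain.* Since `∂_j ψ_i(u) = -B_{ji} + δ_{ij} 2 c_i u_i + ∫ z_j (1 - e^{-⟨u, z⟩}) μ_i(dz)`, the
functions `h_i(t) = e^{-λ₁ t} w_i(t) / φ(i)` solve the backward equation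
`h_i' = ∑_j L_{ij} A_{ij} h_j - κ_i h_i`, `h_i(0) = 1`, with the generator `L` of the spine, the
jump factors `A` and the rates `κ_i = 2 c_i v_i + ∫ z_i (1 - e^{-⟨v, z⟩}) μ_i(dz)`
(`IsMCSBP.hasDerivAt_transform`). A Feynman–Kac formula (`IsMarkovChain.feynman_kac`) identifies
`h_i(t)` with the expectation over the chain started in `i`; averaging over the starting point with
weights `φ(i) x(i) / ⟨φ, x⟩` gives the right side.

The Feynman–Kac formula is proved by discretization. A càdlàg path in a finite set has finitely many
jumps, so along equidistant grids the products over the steps and the Riemann sums converge path by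
path to the weight of the path (`IsCadlag.tendsto_gridWeight`). The expectation of the discretized
weight is a product of one-step operators, by the Markov property at the grid times, and each
one-step operator agrees with the flow of the backward equation up to an error that is uniformly
small compared with the step (`eventually_one_step_error_le`).
-/

namespace MCSBP

/-! ### Càdlàg paths in a discrete space -/

section Paths

variable {S : Type*} [TopologicalSpace S] [DiscreteTopology S]

/-- The jump times of a path. Time `0` is never a jump time, since `Function.leftLim p 0 = p 0`. -/
def jumpTimes (p : ℝ≥0 → S) : Set ℝ≥0 := {s | Function.leftLim p s ≠ p s}

theorem IsCadlag.eventually_eq_leftLim {p : ℝ≥0 → S} (hp : IsCadlag p) (s : ℝ≥0) :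
    ∀ᶠ r in 𝓝[<] s, p r = Function.leftLim p s := by
  have h := tendsto_leftLim_of_tendsto (hp s).2
  rw [nhds_discrete] at h
  exact tendsto_pure.1 h

theorem IsCadlag.eventually_eq_right {p : ℝ≥0 → S} (hp : IsCadlag p) (s : ℝ≥0) :
    ∀ᶠ r in 𝓝[≥] s, p r = p s := by
  have h := (hp s).1
  rw [ContinuousWithinAt, nhds_discrete] at h
  exact tendsto_pure.1 h

theorem IsCadlag.eventually_eq_of_notMem_jumpTimes {p : ℝ≥0 → S} (hp : IsCadlag p) {s : ℝ≥0}
    (hs : s ∉ jumpTimes p) : ∀ᶠ r in 𝓝 s, p r = p s := by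
  have hs' : Function.leftLim p s = p s := not_not.1 hs
  rw [← nhdsLT_sup_nhdsGE, eventually_sup]
  exact ⟨hs' ▸ hp.eventually_eq_leftLim s, hp.eventually_eq_right s⟩

theorem notMem_jumpTimes_of_eventually_eq {p : ℝ≥0 → S} {s : ℝ≥0} {l : S}
    (h : ∀ᶠ r in 𝓝 s, p r = l) : s ∉ jumpTimes p := by
  have hc : ContinuousAt p s := by
    rw [ContinuousAt, nhds_discrete S, h.self_of_nhds]
    exact tendsto_pure.2 h
  exact not_not.2 hc.continuousWithinAt.leftLim_eq

theorem IsCadlag.finite_jumpTimes {p : ℝ≥0 → S} (hp : IsCadlag p) (t : ℝ≥0) :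
    (Set.Iic t ∩ jumpTimes p).Finite := by
  rw [← Set.Icc_bot]
  refine isCompact_Icc.induction_on (p := fun U => (U ∩ jumpTimes p).Finite) (by simp)
    (fun U V hUV hV => hV.subset (Set.inter_subset_inter_left _ hUV))
    (fun U V hU hV => by rw [Set.union_inter_distrib_right]; exact hU.union hV) fun s _ => ?_
  -- Near `s` the path is locally constant except possibly at `s` itself.
  have hl : ∀ᶠ r in 𝓝[<] s, r ∉ jumpTimes p := by
    have h := eventually_eventually_nhdsWithin.2 (hp.eventually_eq_leftLim s)
    filter_upwards [h, self_mem_nhdsWithin] with r hr hrs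
    rw [isOpen_Iio.nhdsWithin_eq hrs] at hr
    exact notMem_jumpTimes_of_eventually_eq hr
  have hr : ∀ᶠ r in 𝓝[>] s, r ∉ jumpTimes p := by
    have h := eventually_eventually_nhdsWithin.2
      ((hp.eventually_eq_right s).filter_mono (nhdsWithin_mono s Set.Ioi_subset_Ici_self))
    filter_upwards [h, self_mem_nhdsWithin] with r hr hrs
    rw [isOpen_Ioi.nhdsWithin_eq hrs] at hr
    exact notMem_jumpTimes_of_eventually_eq hr
  have hne : ∀ᶠ r in 𝓝[≠] s, r ∉ jumpTimes p := by
    rw [← nhdsLT_sup_nhdsGT, eventually_sup]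
    exact ⟨hl, hr⟩
  refine ⟨{r | r ≠ s → r ∉ jumpTimes p},
    mem_nhdsWithin_of_mem_nhds (eventually_nhdsWithin_iff.1 hne), ?_⟩
  refine (Set.finite_singleton s).subset fun r hr => ?_
  by_contra hrs
  exact hr.1 hrs hr.2

theorem IsCadlag.eq_of_no_jump {p : ℝ≥0 → S} (hp : IsCadlag p) {a b : ℝ≥0} (hab : a ≤ b)
    (h : ∀ s ∈ Set.Ioc a b, s ∉ jumpTimes p) : p a = p b := by
  have hc : ContinuousOn p (Set.Icc a b) := by
    intro s hs
    rcases hs.1.eq_or_lt with rfl | hlt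
    · exact (hp a).1.mono Set.Icc_subset_Ici_self
    · have := hp.eventually_eq_of_notMem_jumpTimes (h s ⟨hlt, hs.2⟩)
      refine ContinuousAt.continuousWithinAt ?_
      rw [ContinuousAt, nhds_discrete S]
      exact tendsto_pure.2 this
  exact isPreconnected_Icc.constant_of_mapsTo (T := Set.univ) .univ hc
    (fun _ _ => Set.mem_univ _) ⟨le_rfl, hab⟩ ⟨hab, le_rfl⟩

/-! ### Approximation of path functionals along equidistant grids -/

/-- The `k`-th point of the partition of `[0, t]` into `n` intervals of equal length. -/
noncomputable def grid (t : ℝ≥0) (n k : ℕ) : ℝ≥0 := k * (t / n)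

theorem grid_zero (t : ℝ≥0) (n : ℕ) : grid t n 0 = 0 := by simp [grid]

theorem grid_self (t : ℝ≥0) {n : ℕ} (hn : n ≠ 0) : grid t n n = t := by
  have : (n : ℝ≥0) ≠ 0 := by exact_mod_cast hn
  rw [grid, mul_div_cancel₀ _ this]

theorem grid_succ (t : ℝ≥0) (n k : ℕ) : grid t n (k + 1) = grid t n k + t / n := by
  simp only [grid]; push_cast; ring

theorem grid_mono (t : ℝ≥0) (n : ℕ) : Monotone (grid t n) := fun a b hab => by
  unfold grid; gcongr

theorem tendsto_div_nat (t : ℝ≥0) : Tendsto (fun n : ℕ => t / n) atTop (𝓝 0) := by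
  rw [← NNReal.tendsto_coe]
  simpa using tendsto_const_div_atTop_nhds_zero_nat (t : ℝ)

theorem exists_grid_lt_le {t s : ℝ≥0} (hs : 0 < s) (hst : s ≤ t) {n : ℕ} (hn : n ≠ 0) :
    ∃ k < n, grid t n k < s ∧ s ≤ grid t n (k + 1) := by
  have hex : ∃ k, s ≤ grid t n k := ⟨n, by rwa [grid_self t hn]⟩
  classical
  have h0 : Nat.find hex ≠ 0 := fun h => by
    have := Nat.find_spec hex
    rw [h, grid_zero] at this
    exact absurd hs (not_lt.2 this)
  obtain ⟨k, hk⟩ := Nat.exists_eq_succ_of_ne_zero h0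
  refine ⟨k, ?_, ?_, ?_⟩
  · have : Nat.find hex ≤ n := Nat.find_min' hex (by rwa [grid_self t hn])
    omega
  · exact not_le.1 (Nat.find_min hex (by omega))
  · have := Nat.find_spec hex
    rwa [hk] at this

/-- A product over the jumps of a càdlàg path in a discrete space is the limit of the products
over the steps of a fine grid: a step without a jump contributes the factor `1`, and for a fine
grid no step has two jumps. -/
theorem IsCadlag.tendsto_prod_grid {p : ℝ≥0 → S} (hp : IsCadlag p) {a : ℝ≥0 → S → S → ℝ}
    (ha : ∀ i j, Continuous fun s => a s i j) (ha1 : ∀ s i, a s i i = 1) (t : ℝ≥0) :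
    Tendsto (fun n : ℕ => ∏ k ∈ Finset.range n,
        a (grid t n k) (p (grid t n k)) (p (grid t n (k + 1)))) atTop
      (𝓝 (∏ᶠ (s : ℝ≥0) (_ : s ≤ t), a s (Function.leftLim p s) (p s))) := by
  classical
  set J : Finset ℝ≥0 := (hp.finite_jumpTimes t).toFinset with hJ
  have memJ : ∀ {s}, s ∈ J ↔ s ≤ t ∧ s ∈ jumpTimes p := by simp [hJ]
  have hprod : ∏ᶠ (s : ℝ≥0) (_ : s ≤ t), a s (Function.leftLim p s) (p s)
      = ∏ s ∈ J, a s (Function.leftLim p s) (p s) := by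
    refine finprod_mem_eq_prod_of_inter_mulSupport_eq (s := Set.Iic t) _ ?_
    ext s
    simp only [Set.mem_inter_iff, Set.mem_Iic, Function.mem_mulSupport, Finset.mem_coe, memJ]
    refine ⟨fun h => ⟨⟨h.1, fun he => h.2 ?_⟩, h.2⟩, fun h => ⟨h.1.1, h.2⟩⟩
    rw [he, ha1]
  rw [hprod]
  have hpos : ∀ s ∈ J, 0 < s := fun s hs => by
    refine pos_iff_ne_zero.2 fun h0 => (memJ.1 hs).2 ?_
    exact leftLim_eq_of_isBot (by rw [h0]; exact isBot_bot)
  have hκ : ∀ (n : ℕ) (s : ℝ≥0), ∃ k, n ≠ 0 → s ∈ J →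
      k < n ∧ grid t n k < s ∧ s ≤ grid t n (k + 1) := by
    intro n s
    by_cases h : n ≠ 0 ∧ s ∈ J
    · obtain ⟨k, hk⟩ := exists_grid_lt_le (hpos s h.2) (memJ.1 h.2).1 h.1
      exact ⟨k, fun _ _ => hk⟩
    · exact ⟨0, fun h1 h2 => absurd ⟨h1, h2⟩ h⟩
  choose κ hκ using hκ
  have hne : ∀ᶠ n : ℕ in atTop, n ≠ 0 := eventually_ne_atTop 0
  have hleft : ∀ s ∈ J, Tendsto (fun n => grid t n (κ n s)) atTop (𝓝[<] s) := by
    intro s hs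
    refine tendsto_nhdsWithin_iff.2 ⟨?_, hne.mono fun n hn => (hκ n s hn hs).2.1⟩
    have h1 : Tendsto (fun n : ℕ => s - t / n) atTop (𝓝 s) := by
      simpa using (tendsto_const_nhds (x := s)).sub (tendsto_div_nat t)
    refine tendsto_of_tendsto_of_tendsto_of_le_of_le' h1 tendsto_const_nhds
      (hne.mono fun n hn => ?_) (hne.mono fun n hn => (hκ n s hn hs).2.1.le)
    have := (hκ n s hn hs).2.2
    rw [grid_succ] at this
    exact tsub_le_iff_right.2 this
  have hright : ∀ s ∈ J, Tendsto (fun n => grid t n (κ n s + 1)) atTop (𝓝[≥] s) := by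
    intro s hs
    refine tendsto_nhdsWithin_iff.2 ⟨?_, hne.mono fun n hn => (hκ n s hn hs).2.2⟩
    have := ((hleft s hs).mono_right nhdsWithin_le_nhds).add (tendsto_div_nat t)
    simpa [grid_succ] using this
  have hinj : ∀ᶠ n : ℕ in atTop, Set.InjOn (κ n) J := by
    have : ∀ᶠ n : ℕ in atTop, ∀ s ∈ J, ∀ s' ∈ J, s ≠ s' → κ n s ≠ κ n s' := by
      rw [Finset.eventually_all]
      intro s hs
      rw [Finset.eventually_all]
      intro s' hs'
      by_cases hss : s = s'
      · exact Eventually.of_forall fun _ h => absurd hss h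
      · have h1 := (hleft s hs).mono_right nhdsWithin_le_nhds
        have h2 := (hleft s' hs').mono_right nhdsWithin_le_nhds
        filter_upwards [(h1.prodMk_nhds h2).eventually
          ((isOpen_ne_fun continuous_fst continuous_snd).mem_nhds hss)] with n hn _ he
        exact hn (by rw [he])
    filter_upwards [this] with n hn s hs s' hs' he
    by_contra hss
    exact hn s hs s' hs' hss he
  have heq : ∀ᶠ n : ℕ in atTop,
      ∏ s ∈ J, a (grid t n (κ n s)) (p (grid t n (κ n s))) (p (grid t n (κ n s + 1)))
        = ∏ k ∈ Finset.range n, a (grid t n k) (p (grid t n k)) (p (grid t n (k + 1))) := by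
    filter_upwards [hinj, hne] with n hn hn0
    refine Finset.prod_of_injOn (κ n) hn ?_ ?_ fun _ _ => rfl
    · intro s hs
      simpa using (hκ n s hn0 hs).1
    · intro k hk hkJ
      rw [hp.eq_of_no_jump (grid_mono t n k.le_succ), ha1]
      intro s hs hsJ
      have hsJ' : s ∈ J := by
        refine memJ.2 ⟨hs.2.trans ?_, hsJ⟩
        refine le_of_le_of_eq ?_ (grid_self t hn0)
        exact grid_mono t n (Nat.succ_le_of_lt (Finset.mem_range.1 hk))
      refine hkJ ⟨s, hsJ', ?_⟩
      obtain ⟨_, h1, h2⟩ := hκ n s hn0 hsJ'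
      have h3 : κ n s < k + 1 := (grid_mono t n).reflect_lt (h1.trans_le hs.2)
      have h4 : k < κ n s + 1 := (grid_mono t n).reflect_lt (hs.1.trans_le h2)
      omega
  refine Tendsto.congr' heq (tendsto_finsetProd J fun s hs => ?_)
  have h1 : ∀ᶠ n : ℕ in atTop, a (grid t n (κ n s)) (Function.leftLim p s) (p s)
      = a (grid t n (κ n s)) (p (grid t n (κ n s))) (p (grid t n (κ n s + 1))) := by
    filter_upwards [(hleft s hs).eventually (hp.eventually_eq_leftLim s),
      (hright s hs).eventually (hp.eventually_eq_right s)] with n h1 h2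
    rw [h1, h2]
  exact Tendsto.congr' h1 (((ha _ _).tendsto s).comp ((hleft s hs).mono_right nhdsWithin_le_nhds))

/-- Left Riemann sums of a bounded function with finitely many discontinuities converge. -/
theorem tendsto_riemann_sum {q : ℝ≥0 → ℝ} {t : ℝ≥0} {C : ℝ} (hC : ∀ s ≤ t, |q s| ≤ C)
    {J : Set ℝ≥0} (hJ : J.Finite) (hq : ∀ s ≤ t, s ∉ J → ContinuousAt q s) :
    Tendsto (fun n : ℕ => ∑ k ∈ Finset.range n, ((t / n : ℝ≥0) : ℝ) * q (grid t n k)) atTop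
      (𝓝 (∫ s in (0 : ℝ)..t, q s.toNNReal)) := by
  rcases eq_or_ne t 0 with rfl | ht
  · simp
  have ht0 : (0 : ℝ) < t := NNReal.coe_pos.2 (pos_iff_ne_zero.2 ht)
  -- The index of the grid interval that contains `s`.
  let N : ℕ → ℝ → ℕ := fun n s => ⌊s / ((t / n : ℝ≥0) : ℝ)⌋₊
  have hδ : ∀ {n : ℕ}, n ≠ 0 → (0 : ℝ) < ((t / n : ℝ≥0) : ℝ) := fun {n} hn => by
    rw [NNReal.coe_pos]
    exact div_pos (pos_iff_ne_zero.2 ht) (by exact_mod_cast Nat.pos_of_ne_zero hn)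
  have hcoe : ∀ n k, ((grid t n k : ℝ≥0) : ℝ) = k * ((t / n : ℝ≥0) : ℝ) := fun n k => by
    simp [grid]
  have hmeas : ∀ n, Measurable fun s => q (grid t n (N n s)) := fun n =>
    (measurable_from_nat (f := fun k => q (grid t n k))).comp
      (Nat.measurable_floor.comp (measurable_id.div_const _))
  have hle : ∀ {n : ℕ}, n ≠ 0 → ∀ {s : ℝ}, 0 ≤ s →
      ((grid t n (N n s) : ℝ≥0) : ℝ) ≤ s := fun {n} hn {s} hs => by
    rw [hcoe, ← le_div_iff₀ (hδ hn)]
    exact Nat.floor_le (div_nonneg hs (hδ hn).le)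
  have hbound : ∀ {n : ℕ}, n ≠ 0 → ∀ {s : ℝ}, 0 ≤ s → s ≤ t →
      |q (grid t n (N n s))| ≤ C := fun {n} hn {s} hs hst =>
    hC _ (NNReal.coe_le_coe.1 ((hle hn hs).trans hst))
  have hsum : ∀ᶠ n : ℕ in atTop, ∫ s in (0 : ℝ)..t, q (grid t n (N n s))
      = ∑ k ∈ Finset.range n, ((t / n : ℝ≥0) : ℝ) * q (grid t n k) := by
    filter_upwards [eventually_ne_atTop 0] with n hn
    have hint : ∀ k < n, IntervalIntegrable (fun s => q (grid t n (N n s))) volume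
        (grid t n k : ℝ≥0) (grid t n (k + 1) : ℝ≥0) := by
      intro k hk
      rw [intervalIntegrable_iff, Set.uIoc_of_le (NNReal.coe_le_coe.2 (grid_mono t n k.le_succ))]
      refine Measure.integrableOn_of_bounded (M := C) (by simp)
        (hmeas n).aestronglyMeasurable ?_
      filter_upwards [ae_restrict_mem measurableSet_Ioc] with s hs
      refine hbound hn ((NNReal.coe_nonneg _).trans hs.1.le) (hs.2.trans ?_)
      rw [NNReal.coe_le_coe]
      calc grid t n (k + 1) ≤ grid t n n := grid_mono t n (Nat.succ_le_of_lt hk)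
        _ = t := grid_self t hn
    have h := intervalIntegral.sum_integral_adjacent_intervals
      (a := fun k => ((grid t n k : ℝ≥0) : ℝ)) hint
    simp only [grid_zero, grid_self t hn, NNReal.coe_zero] at h
    rw [← h]
    refine Finset.sum_congr rfl fun k _ => ?_
    have hcongr : Set.EqOn (fun s => q (grid t n (N n s))) (fun _ => q (grid t n k))
        (Set.Ioo ((grid t n k : ℝ≥0) : ℝ) ((grid t n (k + 1) : ℝ≥0) : ℝ)) := by
      intro s hs
      rw [hcoe, hcoe] at hs
      have : N n s = k := by
        refine (Nat.floor_eq_iff (div_nonneg ?_ (hδ hn).le)).2 ⟨?_, ?_⟩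
        · exact le_trans (by have := hδ hn; positivity) hs.1.le
        · exact (le_div_iff₀ (hδ hn)).2 hs.1.le
        · exact (div_lt_iff₀ (hδ hn)).2 (by simpa using hs.2)
      simp only [this]
    rw [intervalIntegral.integral_congr_Ioo_of_le
      (NNReal.coe_le_coe.2 (grid_mono t n k.le_succ)) hcongr]
    simp [grid_succ]
  refine Tendsto.congr' hsum ?_
  refine intervalIntegral.tendsto_integral_filter_of_dominated_convergence (fun _ => C)
    (Eventually.of_forall fun n => (hmeas n).aestronglyMeasurable) ?_ (by simp) ?_
  · filter_upwards [eventually_ne_atTop 0] with n hn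
    refine Eventually.of_forall fun s hs => ?_
    rw [Set.uIoc_of_le ht0.le] at hs
    exact hbound hn hs.1.le hs.2
  · have hnull : ∀ᵐ s : ℝ, s ∉ ((↑) : ℝ≥0 → ℝ) '' J :=
      (hJ.image _).measure_zero volume |> measure_eq_zero_iff_ae_notMem.1
    filter_upwards [hnull] with s hsJ hs
    rw [Set.uIoc_of_le ht0.le] at hs
    have hsJ' : s.toNNReal ∉ J := fun h => hsJ ⟨_, h, Real.coe_toNNReal s hs.1.le⟩
    have hc := hq s.toNNReal (Real.toNNReal_le_iff_le_coe.2 hs.2) hsJ'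
    refine hc.tendsto.comp ?_
    rw [← NNReal.tendsto_coe, Real.coe_toNNReal s hs.1.le]
    have h1 : Tendsto (fun n : ℕ => s - ((t / n : ℝ≥0) : ℝ)) atTop (𝓝 s) := by
      simpa using (tendsto_const_nhds (x := s)).sub (NNReal.tendsto_coe.2 (tendsto_div_nat t))
    refine tendsto_of_tendsto_of_tendsto_of_le_of_le' h1 tendsto_const_nhds
      ((eventually_ne_atTop 0).mono fun n hn => ?_)
      ((eventually_ne_atTop 0).mono fun n hn => hle hn hs.1.le)
    have := (Nat.lt_floor_add_one (s / ((t / n : ℝ≥0) : ℝ))).le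
    rw [div_le_iff₀ (hδ hn)] at this
    rw [hcoe]
    linarith

theorem IsCadlag.tendsto_riemann_sum [Finite S] {p : ℝ≥0 → S} (hp : IsCadlag p)
    {g : ℝ≥0 → S → ℝ} (hg : ∀ i, Continuous fun s => g s i) (t : ℝ≥0) :
    Tendsto (fun n : ℕ => ∑ k ∈ Finset.range n,
        ((t / n : ℝ≥0) : ℝ) * g (grid t n k) (p (grid t n k))) atTop
      (𝓝 (∫ s in (0 : ℝ)..t, g s.toNNReal (p s.toNNReal))) := by
  have hb : ∀ i, ∃ C, ∀ s ∈ Set.Icc 0 t, ‖g s i‖ ≤ C := fun i =>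
    isCompact_Icc.exists_bound_of_continuousOn (hg i).continuousOn
  choose C hC using hb
  obtain ⟨M, hM⟩ := (Set.finite_range C).bddAbove
  refine MCSBP.tendsto_riemann_sum (q := fun s => g s (p s)) (C := M)
    (fun s hs => (hC _ s ⟨zero_le, hs⟩).trans (hM ⟨_, rfl⟩)) (hp.finite_jumpTimes t) ?_
  intro s hs hsJ
  have hev := hp.eventually_eq_of_notMem_jumpTimes fun h => hsJ ⟨hs, h⟩
  refine ((hg (p s)).continuousAt (x := s)).congr ?_
  filter_upwards [hev] with r hr
  simp only [hr]

end Paths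

/-! ### The matrix exponential of a generator -/

section MatrixExp

variable {d : ℕ}

theorem hasDerivAt_matrix_exp_entry (L : Matrix (Fin d) (Fin d) ℝ) (i j : Fin d) (τ : ℝ) :
    HasDerivAt (fun u : ℝ => NormedSpace.exp (u • L) i j)
      ((NormedSpace.exp (τ • L) * L) i j) τ := by
  let _ : NormedRing (Matrix (Fin d) (Fin d) ℝ) := Matrix.linftyOpNormedRing
  let _ : NormedAlgebra ℝ (Matrix (Fin d) (Fin d) ℝ) := Matrix.linftyOpNormedAlgebra
  have h := hasDerivAt_exp_smul_const L τ
  exact (LinearMap.toContinuousLinearMap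
    (Matrix.entryLinearMap ℝ ℝ i j)).hasFDerivAt.comp_hasDerivAt τ h

theorem matrix_exp_nonneg {N : Matrix (Fin d) (Fin d) ℝ} (hN : ∀ i j, 0 ≤ N i j) (i j : Fin d) :
    0 ≤ NormedSpace.exp N i j := by
  let _ : NormedRing (Matrix (Fin d) (Fin d) ℝ) := Matrix.linftyOpNormedRing
  let _ : NormedAlgebra ℝ (Matrix (Fin d) (Fin d) ℝ) := Matrix.linftyOpNormedAlgebra
  have h := NormedSpace.exp_series_hasSum_exp' (𝕂 := ℝ) N
  have h2 := (LinearMap.toContinuousLinearMap (Matrix.entryLinearMap ℝ ℝ i j)).hasSum h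
  refine h2.nonneg fun n => ?_
  have hpow : ∀ (n : ℕ) (i j : Fin d), 0 ≤ (N ^ n) i j := by
    intro n
    induction n with
    | zero =>
      intro i j
      rw [pow_zero, Matrix.one_apply]
      split_ifs <;> norm_num
    | succ n ih =>
      intro i j
      rw [pow_succ, Matrix.mul_apply]
      exact Finset.sum_nonneg fun k _ => mul_nonneg (ih i k) (hN k j)
  have : 0 ≤ ((n.factorial : ℝ)⁻¹) * (N ^ n) i j := mul_nonneg (by positivity) (hpow n i j)
  simpa using this

/-- The semigroup generated by a matrix with non-negative off-diagonal entries is non-negative: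
adding a multiple of the identity to the matrix makes all its entries non-negative. -/
theorem matrix_exp_smul_nonneg {L : Matrix (Fin d) (Fin d) ℝ} (hL : ∀ i j, i ≠ j → 0 ≤ L i j)
    {τ : ℝ} (hτ : 0 ≤ τ) (i j : Fin d) : 0 ≤ NormedSpace.exp (τ • L) i j := by
  set c : ℝ := ∑ i, |L i i| with hc
  set N : Matrix (Fin d) (Fin d) ℝ := τ • (L + Matrix.diagonal fun _ => c) with hN
  have hN0 : ∀ i j, 0 ≤ N i j := by
    intro i j
    refine mul_nonneg hτ ?_
    rcases eq_or_ne i j with rfl | hij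
    · have h1 : |L i i| ≤ c :=
        Finset.single_le_sum (f := fun i => |L i i|) (fun i _ => abs_nonneg _) (Finset.mem_univ i)
      have h2 := neg_abs_le (L i i)
      simp only [Matrix.add_apply, Matrix.diagonal_apply_eq]
      linarith
    · simpa [Matrix.diagonal_apply_ne _ hij] using hL i j hij
  have hsplit : τ • L = N + Matrix.diagonal fun _ => -(τ * c) := by
    ext i j
    rcases eq_or_ne i j with rfl | hij
    · simp [hN]
    · simp [hN, Matrix.diagonal_apply_ne _ hij]
  have hcomm : Commute N (Matrix.diagonal fun _ => -(τ * c)) :=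
    (Matrix.scalar_commute (-(τ * c)) (fun _ => mul_comm _ _) N).symm
  rw [hsplit, Matrix.exp_add_of_commute _ _ hcomm, Matrix.exp_diagonal, Matrix.mul_diagonal]
  refine mul_nonneg (matrix_exp_nonneg hN0 i j) ?_
  rw [Pi.coe_exp, ← Real.exp_eq_exp_ℝ]
  exact (Real.exp_pos _).le

end MatrixExp

/-! ### A Feynman–Kac formula for finite Markov chains -/

section FeynmanKac

variable {d : ℕ} {L : Matrix (Fin d) (Fin d) ℝ} {Ω : Type*} [MeasurableSpace Ω]
  {P : Fin d → Measure Ω} {η : ℝ≥0 → Ω → Fin d}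

/-- The Markov property of one transition, tested against a random variable `Z` of the past. -/
theorem IsMarkovChain.integral_transition (hη : IsMarkovChain L P η)
    (hL : ∀ i j, i ≠ j → 0 ≤ L i j) (i : Fin d) (s τ : ℝ≥0) {Z : Ω → ℝ} {C : ℝ}
    (hZ : StronglyMeasurable[Filtration.natural η hη.stronglyMeasurable s] Z)
    (hZC : ∀ ω, |Z ω| ≤ C) (H : Fin d → Fin d → ℝ) :
    ∫ ω, Z ω * H (η s ω) (η (s + τ) ω) ∂(P i)
      = ∫ ω, Z ω * ∑ k, NormedSpace.exp ((τ : ℝ) • L) (η s ω) k * H (η s ω) k ∂(P i) := by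
  have := hη.isProbabilityMeasure i
  set F := Filtration.natural η hη.stronglyMeasurable with hF
  have hm : F s ≤ _ := F.le s
  have hmeasη : ∀ r j, MeasurableSet {ω | η r ω = j} := fun r j =>
    (hη.stronglyMeasurable r).measurable (measurableSet_singleton j)
  have hadapt : ∀ j, MeasurableSet[F s] {ω | η s ω = j} := fun j =>
    (Filtration.stronglyAdapted_natural hη.stronglyMeasurable s).measurable
      (measurableSet_singleton j)
  have hZint : Integrable Z (P i) :=
    Integrable.of_bound (hZ.mono hm).aestronglyMeasurable C (Eventually.of_forall hZC)
  let q : Fin d → Fin d → ℝ := fun j k => NormedSpace.exp ((τ : ℝ) • L) j k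
  have hq : ∀ j k, 0 ≤ q j k := matrix_exp_smul_nonneg hL τ.2
  have hmarkov : ∀ A, MeasurableSet[F s] A → ∀ j k,
      P i (A ∩ {ω | η s ω = j} ∩ {ω | η (s + τ) ω = k})
        = P i (A ∩ {ω | η s ω = j}) * ENNReal.ofReal (q j k) := hη.markov i s τ
  change _ = ∫ ω, Z ω * ∑ k, q (η s ω) k * H (η s ω) k ∂(P i)
  have hset : ∀ j k, ∫ ω in {ω | η s ω = j} ∩ {ω | η (s + τ) ω = k}, Z ω ∂(P i)
      = q j k * ∫ ω in {ω | η s ω = j}, Z ω ∂(P i) := by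
    intro j k
    have htrim : ((P i).restrict ({ω | η s ω = j} ∩ {ω | η (s + τ) ω = k})).trim hm
        = ENNReal.ofReal (q j k) •
          ((P i).restrict {ω | η s ω = j}).trim hm := by
      refine @Measure.ext _ (F s) _ _ fun A hA => ?_
      rw [Measure.smul_apply, trim_measurableSet_eq hm hA, trim_measurableSet_eq hm hA,
        Measure.restrict_apply (hm _ hA), Measure.restrict_apply (hm _ hA), ← Set.inter_assoc,
        hmarkov A hA j k, smul_eq_mul, mul_comm]
    rw [integral_trim hm hZ, htrim, integral_smul_measure, ← integral_trim hm hZ,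
      ENNReal.toReal_ofReal (hq j k), smul_eq_mul]
  have hl : ∀ ω, Z ω * H (η s ω) (η (s + τ) ω)
      = ∑ j, ∑ k, H j k * ({ω | η s ω = j} ∩ {ω | η (s + τ) ω = k}).indicator Z ω := by
    intro ω
    rw [Finset.sum_eq_single (η s ω), Finset.sum_eq_single (η (s + τ) ω)]
    · rw [Set.indicator_of_mem (by exact ⟨rfl, rfl⟩), mul_comm]
    · intro k _ hk
      rw [Set.indicator_of_notMem (fun h => hk h.2.symm), mul_zero]
    · simp
    · intro j _ hj
      refine Finset.sum_eq_zero fun k _ => ?_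
      rw [Set.indicator_of_notMem (fun h => hj h.1.symm), mul_zero]
    · simp
  have hr : ∀ ω, Z ω * ∑ k, q (η s ω) k * H (η s ω) k
      = ∑ j, ∑ k, H j k * (q j k *
          {ω | η s ω = j}.indicator Z ω) := by
    intro ω
    symm
    rw [Finset.sum_eq_single (η s ω), Finset.mul_sum]
    · refine Finset.sum_congr rfl fun k _ => ?_
      rw [Set.indicator_of_mem (by exact rfl)]
      ring
    · intro j _ hj
      refine Finset.sum_eq_zero fun k _ => ?_
      rw [Set.indicator_of_notMem (by exact fun h => hj (Eq.symm h)), mul_zero, mul_zero]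
    · simp
  have hint1 : ∀ j k, Integrable
      (fun ω => H j k * ({ω | η s ω = j} ∩ {ω | η (s + τ) ω = k}).indicator Z ω) (P i) :=
    fun j k => (hZint.indicator ((hmeasη s j).inter (hmeasη (s + τ) k))).const_mul _
  have hint2 : ∀ j k, Integrable (fun ω => H j k * (q j k *
      {ω | η s ω = j}.indicator Z ω)) (P i) :=
    fun j k => ((hZint.indicator (hmeasη s j)).const_mul _).const_mul _
  simp_rw [hl, hr]
  rw [integral_finsetSum _ fun j _ => integrable_finsetSum _ fun k _ => hint1 j k,
    integral_finsetSum _ fun j _ => integrable_finsetSum _ fun k _ => hint2 j k]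
  refine Finset.sum_congr rfl fun j _ => ?_
  rw [integral_finsetSum _ fun k _ => hint1 j k, integral_finsetSum _ fun k _ => hint2 j k]
  refine Finset.sum_congr rfl fun k _ => ?_
  rw [integral_const_mul, integral_const_mul, integral_const_mul,
    integral_indicator ((hmeasη s j).inter (hmeasη (s + τ) k)), integral_indicator (hmeasη s j),
    hset]

/-- Consistency of the one-step operators with the backward equation `h' = (L ∘ a - κ) h`: over a
step of length `τ` the error is `o(τ)`, uniformly on compact time intervals. In the proof the error
is a function of `τ` whose derivative vanishes at `τ = 0` and is jointly continuous in the time `r`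
and `τ`. -/
theorem eventually_one_step_error_le (L : Matrix (Fin d) (Fin d) ℝ)
    {a : ℝ≥0 → Fin d → Fin d → ℝ} {κ : ℝ≥0 → Fin d → ℝ} {h : ℝ → Fin d → ℝ}
    (ha : ∀ i j, Continuous fun s => a s i j) (ha1 : ∀ s i, a s i i = 1)
    (hκ : ∀ i, Continuous fun s => κ s i) (hh : ∀ i, Continuous fun r => h r i)
    (hderiv : ∀ i, ∀ r > 0, HasDerivAt (fun r => h r i)
      (∑ j, L i j * a r.toNNReal i j * h r j - κ r.toNNReal i * h r i) r)
    (T : ℝ) {ε : ℝ} (hε : 0 < ε) :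
    ∀ᶠ τ in 𝓝[≥] (0 : ℝ), ∀ r ∈ Set.Icc τ T, ∀ i,
      |∑ j, NormedSpace.exp (τ • L) i j *
          (a r.toNNReal i j * Real.exp (-(τ * κ r.toNNReal i)) * h (r - τ) j) - h r i|
        ≤ ε * τ := by
  have hE : ∀ i j, Continuous fun τ : ℝ => NormedSpace.exp (τ • L) i j := fun i j =>
    continuous_iff_continuousAt.2 fun τ => (hasDerivAt_matrix_exp_entry L i j τ).continuousAt
  have hE' : ∀ i j, Continuous fun τ : ℝ => (NormedSpace.exp (τ • L) * L) i j := by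
    intro i j
    simp only [Matrix.mul_apply]
    exact continuous_finsetSum _ fun k _ => (hE i k).mul continuous_const
  let g : ℝ → Fin d → ℝ := fun r i =>
    ∑ j, L i j * a r.toNNReal i j * h r j - κ r.toNNReal i * h r i
  have ha' : ∀ i j, Continuous fun r : ℝ => a r.toNNReal i j := fun i j =>
    (ha i j).comp continuous_real_toNNReal
  have hκ' : ∀ i, Continuous fun r : ℝ => κ r.toNNReal i := fun i =>
    (hκ i).comp continuous_real_toNNReal
  have hg : ∀ i, Continuous fun r => g r i := fun i =>
    (continuous_finsetSum _ fun j _ => (continuous_const.mul (ha' i j)).mul (hh j)).sub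
      ((hκ' i).mul (hh i))
  -- `D τ r i` is the derivative in `τ` of the one-step operator applied to `h (r - τ)`.
  let D : ℝ → ℝ → Fin d → ℝ := fun τ r i => ∑ j,
    ((NormedSpace.exp (τ • L) * L) i j *
        (a r.toNNReal i j * Real.exp (-(τ * κ r.toNNReal i)) * h (r - τ) j)
      + NormedSpace.exp (τ • L) i j *
        (a r.toNNReal i j * (Real.exp (-(τ * κ r.toNNReal i)) * -κ r.toNNReal i) * h (r - τ) j
          + a r.toNNReal i j * Real.exp (-(τ * κ r.toNNReal i)) * -g (r - τ) j))
  have hDc : ∀ i, Continuous fun z : ℝ × ℝ => D z.1 z.2 i := by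
    intro i
    refine continuous_finsetSum _ fun j _ => ?_
    have h1 : Continuous fun z : ℝ × ℝ => NormedSpace.exp (z.1 • L) i j :=
      (hE i j).comp continuous_fst
    have h2 : Continuous fun z : ℝ × ℝ => (NormedSpace.exp (z.1 • L) * L) i j :=
      (hE' i j).comp continuous_fst
    have h3 : Continuous fun z : ℝ × ℝ => a z.2.toNNReal i j := (ha' i j).comp continuous_snd
    have h4 : Continuous fun z : ℝ × ℝ => κ z.2.toNNReal i := (hκ' i).comp continuous_snd
    have h5 : Continuous fun z : ℝ × ℝ => h (z.2 - z.1) j :=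
      (hh j).comp (continuous_snd.sub continuous_fst)
    have h6 : Continuous fun z : ℝ × ℝ => g (z.2 - z.1) j :=
      (hg j).comp (continuous_snd.sub continuous_fst)
    have h7 : Continuous fun z : ℝ × ℝ => Real.exp (-(z.1 * κ z.2.toNNReal i)) :=
      Real.continuous_exp.comp (continuous_fst.mul h4).neg
    exact (h2.mul ((h3.mul h7).mul h5)).add
      (h1.mul (((h3.mul (h7.mul h4.neg)).mul h5).add ((h3.mul h7).mul h6.neg)))
  have hD0 : ∀ r i, D 0 r i = 0 := by
    intro r i
    have h1 : ∀ j, NormedSpace.exp ((0 : ℝ) • L) i j = if i = j then 1 else 0 := by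
      intro j
      rw [zero_smul, NormedSpace.exp_zero, Matrix.one_apply]
    simp only [D, zero_smul, NormedSpace.exp_zero, zero_mul, neg_zero,
      Real.exp_zero, sub_zero, Matrix.one_apply, mul_one, Finset.sum_add_distrib, ite_mul,
      one_mul, Finset.sum_ite_eq, Finset.mem_univ, if_true, ha1, g, ← mul_assoc]
    ring
  have hsmall : ∀ᶠ τ in 𝓝 (0 : ℝ), ∀ r ∈ Set.Icc 0 T, ∀ i, |D τ r i| < ε := by
    refine isCompact_Icc.eventually_forall_of_forall_eventually fun r _ => ?_
    refine eventually_all.2 fun i => ?_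
    refine (hDc i).abs.continuousAt.eventually_lt continuousAt_const ?_
    simpa [hD0] using hε
  obtain ⟨δ, hδ, hball⟩ := Metric.eventually_nhds_iff.1 hsmall
  have hlt : ∀ᶠ τ in 𝓝[≥] (0 : ℝ), τ < δ := mem_nhdsWithin_of_mem_nhds (Iio_mem_nhds hδ)
  filter_upwards [hlt, self_mem_nhdsWithin] with τ hτδ hτ0 r hr i
  have hτ0 : (0 : ℝ) ≤ τ := hτ0
  let Ψ : ℝ → ℝ := fun σ => ∑ j, NormedSpace.exp (σ • L) i j *
    (a r.toNNReal i j * Real.exp (-(σ * κ r.toNNReal i)) * h (r - σ) j)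
  have hΨc : Continuous Ψ := by
    refine continuous_finsetSum _ fun j _ => (hE i j).mul (Continuous.mul ?_ ?_)
    · fun_prop
    · exact (hh j).comp (continuous_const.sub continuous_id)
  have hΨd : ∀ σ ∈ Set.Ico 0 τ, HasDerivWithinAt Ψ (D σ r i) (Set.Ici σ) σ := by
    intro σ hσ
    refine HasDerivAt.hasDerivWithinAt ?_
    refine HasDerivAt.fun_sum fun j _ => (hasDerivAt_matrix_exp_entry L i j σ).mul ?_
    refine HasDerivAt.mul (HasDerivAt.const_mul _ ?_) ?_
    · have h1 : HasDerivAt (fun σ : ℝ => -(σ * κ r.toNNReal i)) (-κ r.toNNReal i) σ := by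
        simpa using! ((hasDerivAt_id σ).mul_const (κ r.toNNReal i)).neg
      exact h1.exp
    · have h1 : HasDerivAt (fun σ : ℝ => r - σ) (-1) σ := by
        simpa using (hasDerivAt_id σ).const_sub r
      have h2 := (hderiv j (r - σ) (by linarith [hr.1, hσ.2])).comp σ h1
      simpa [g, Function.comp_def] using! h2
  have hb : ∀ σ ∈ Set.Ico 0 τ, ‖D σ r i‖ ≤ ε := by
    intro σ hσ
    refine (hball ?_ r ⟨hτ0.trans hr.1, hr.2⟩ i).le
    rw [Real.dist_eq, sub_zero, abs_of_nonneg hσ.1]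
    exact hσ.2.trans hτδ
  have hmvt := norm_image_sub_le_of_norm_deriv_right_le_segment hΨc.continuousOn hΨd hb τ
    ⟨hτ0, le_rfl⟩
  have hΨ0 : Ψ 0 = h r i := by
    simp [Ψ, Matrix.one_apply, ha1]
  rw [hΨ0, sub_zero] at hmvt
  exact hmvt

/-- The Feynman–Kac weight of a path `p` up to time `t`. The jump factors `a` and the killing rate
`κ` are evaluated at the remaining time `t - s`. -/
noncomputable def feynmanKacWeight (a : ℝ≥0 → Fin d → Fin d → ℝ) (κ : ℝ≥0 → Fin d → ℝ) (t : ℝ≥0)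
    (p : ℝ≥0 → Fin d) : ℝ :=
  Real.exp (-∫ s in (0 : ℝ)..t, κ (t - s.toNNReal) (p s.toNNReal)) *
    ∏ᶠ (s : ℝ≥0) (_ : s ≤ t), a (t - s) (Function.leftLim p s) (p s)

/-- The discretization of `feynmanKacWeight` along the first `m` steps of the grid of `n` steps. -/
noncomputable def gridWeight (a : ℝ≥0 → Fin d → Fin d → ℝ) (κ : ℝ≥0 → Fin d → ℝ) (t : ℝ≥0)
    (n m : ℕ) (p : ℝ≥0 → Fin d) : ℝ :=
  ∏ k ∈ Finset.range m, a (t - grid t n k) (p (grid t n k)) (p (grid t n (k + 1))) *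
    Real.exp (-(((t / n : ℝ≥0) : ℝ) * κ (t - grid t n k) (p (grid t n k))))

variable {a : ℝ≥0 → Fin d → Fin d → ℝ} {κ : ℝ≥0 → Fin d → ℝ}

theorem abs_gridWeight_le_one (ha0 : ∀ s i j, 0 ≤ a s i j) (ha_le : ∀ s i j, a s i j ≤ 1)
    (hκ0 : ∀ s i, 0 ≤ κ s i) (t : ℝ≥0) (n m : ℕ) (p : ℝ≥0 → Fin d) :
    |gridWeight a κ t n m p| ≤ 1 := by
  have h0 : ∀ k ∈ Finset.range m, 0 ≤ a (t - grid t n k) (p (grid t n k)) (p (grid t n (k + 1))) *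
      Real.exp (-(((t / n : ℝ≥0) : ℝ) * κ (t - grid t n k) (p (grid t n k)))) :=
    fun k _ => mul_nonneg (ha0 _ _ _) (Real.exp_pos _).le
  rw [gridWeight, abs_of_nonneg (Finset.prod_nonneg h0)]
  refine Finset.prod_le_one h0 fun k _ => mul_le_one₀ (ha_le _ _ _) (Real.exp_pos _).le ?_
  exact Real.exp_le_one_iff.2 (neg_nonpos.2 (mul_nonneg (NNReal.coe_nonneg _) (hκ0 _ _)))

theorem IsCadlag.tendsto_gridWeight {p : ℝ≥0 → Fin d} (hp : IsCadlag p)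
    (ha : ∀ i j, Continuous fun s => a s i j) (ha1 : ∀ s i, a s i i = 1)
    (hκ : ∀ i, Continuous fun s => κ s i) (t : ℝ≥0) :
    Tendsto (fun n => gridWeight a κ t n n p) atTop (𝓝 (feynmanKacWeight a κ t p)) := by
  have h1 := hp.tendsto_prod_grid (a := fun s i j => a (t - s) i j)
    (fun i j => (ha i j).comp (continuous_const.sub continuous_id)) (fun s i => ha1 _ i) t
  have h2 := hp.tendsto_riemann_sum (g := fun s i => κ (t - s) i)
    (fun i => (hκ i).comp (continuous_const.sub continuous_id)) t
  have h3 := (Real.continuous_exp.tendsto _).comp h2.neg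
  refine (h3.mul h1).congr fun n => ?_
  rw [gridWeight, Finset.prod_mul_distrib, ← Real.exp_sum, Finset.sum_neg_distrib, mul_comm]
  rfl

theorem stronglyMeasurable_gridWeight (hη : ∀ t, StronglyMeasurable (η t)) (t : ℝ≥0) (n m : ℕ) :
    StronglyMeasurable[Filtration.natural η hη (grid t n m)]
      fun ω => gridWeight a κ t n m fun r => η r ω := by
  have hadapt : ∀ k ≤ m, Measurable[Filtration.natural η hη (grid t n m)]
      (η (grid t n k)) := fun k hk =>
    ((Filtration.stronglyAdapted_natural hη (grid t n k)).mono
      ((Filtration.natural η hη).mono (grid_mono t n hk))).measurable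
  refine Finset.stronglyMeasurable_fun_prod _ fun k hk => ?_
  have hk' := Finset.mem_range.1 hk
  have h : Measurable fun ij : Fin d × Fin d => a (t - grid t n k) ij.1 ij.2 *
    Real.exp (-(((t / n : ℝ≥0) : ℝ) * κ (t - grid t n k) ij.1)) := Measurable.of_discrete
  exact (h.comp ((hadapt k hk'.le).prodMk (hadapt (k + 1) hk'))).stronglyMeasurable

/-- **Feynman–Kac formula** for a finite Markov chain with generator `L`: the expected weight of
the path up to time `t`, started in `i`, is `h t i`, where `h` is the solution of the backward
equation `h' = (L ∘ a - κ) h` with `h 0 = 1`. -/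
theorem IsMarkovChain.feynman_kac (hη : IsMarkovChain L P η) (hL : ∀ i j, i ≠ j → 0 ≤ L i j)
    {h : ℝ → Fin d → ℝ}
    (ha : ∀ i j, Continuous fun s => a s i j) (ha0 : ∀ s i j, 0 ≤ a s i j)
    (ha_le : ∀ s i j, a s i j ≤ 1) (ha1 : ∀ s i, a s i i = 1)
    (hκ : ∀ i, Continuous fun s => κ s i) (hκ0 : ∀ s i, 0 ≤ κ s i)
    (hh : ∀ i, Continuous fun r => h r i)
    (hderiv : ∀ i, ∀ r > 0, HasDerivAt (fun r => h r i)
      (∑ j, L i j * a r.toNNReal i j * h r j - κ r.toNNReal i * h r i) r)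
    (hinit : ∀ i, h 0 i = 1) (t : ℝ≥0) (i : Fin d) :
    Integrable (fun ω => feynmanKacWeight a κ t fun r => η r ω) (P i) ∧
      ∫ ω, feynmanKacWeight a κ t (fun r => η r ω) ∂(P i) = h t i := by
  have := hη.isProbabilityMeasure i
  let F := Filtration.natural η hη.stronglyMeasurable
  let Z : ℕ → ℕ → Ω → ℝ := fun n m ω => gridWeight a κ t n m fun r => η r ω
  have hZb : ∀ n m ω, |Z n m ω| ≤ 1 := fun n m ω => abs_gridWeight_le_one ha0 ha_le hκ0 t n m _
  have hZF : ∀ n m, StronglyMeasurable[F (grid t n m)] (Z n m) := fun n m =>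
    stronglyMeasurable_gridWeight hη.stronglyMeasurable t n m
  have hZm : ∀ n m, StronglyMeasurable (Z n m) := fun n m => (hZF n m).mono (F.le _)
  have hlim : ∀ ω, Tendsto (fun n => Z n n ω) atTop
      (𝓝 (feynmanKacWeight a κ t fun r => η r ω)) := fun ω =>
    (hη.cadlag ω).tendsto_gridWeight ha ha1 hκ t
  have hYm : StronglyMeasurable fun ω => feynmanKacWeight a κ t fun r => η r ω :=
    stronglyMeasurable_of_tendsto atTop (fun n => hZm n n) (tendsto_pi_nhds.2 hlim)
  have hYb : ∀ ω, ‖feynmanKacWeight a κ t fun r => η r ω‖ ≤ 1 := fun ω =>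
    le_of_tendsto (hlim ω).norm (Eventually.of_forall fun n => hZb n n ω)
  refine ⟨Integrable.of_bound hYm.aestronglyMeasurable 1 (Eventually.of_forall hYb), ?_⟩
  have hlimE : Tendsto (fun n => ∫ ω, Z n n ω ∂(P i)) atTop
      (𝓝 (∫ ω, feynmanKacWeight a κ t (fun r => η r ω) ∂(P i))) :=
    tendsto_integral_of_dominated_convergence (fun _ => 1)
      (fun n => (hZm n n).aestronglyMeasurable) (integrable_const 1)
      (fun n => Eventually.of_forall (hZb n n)) (Eventually.of_forall hlim)
  refine tendsto_nhds_unique hlimE ?_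
  have hint : ∀ n m (f : Fin d → ℝ),
      Integrable (fun ω => Z n m ω * f (η (grid t n m) ω)) (P i) := by
    intro n m f
    refine Integrable.of_bound (C := ∑ j, |f j|) ?_ (Eventually.of_forall fun ω => ?_)
    · refine ((hZm n m).mul ?_).aestronglyMeasurable
      exact ((Measurable.of_discrete (f := f)).comp
        (hη.stronglyMeasurable (grid t n m)).measurable).stronglyMeasurable
    · rw [norm_mul]
      have h1 : |f (η (grid t n m) ω)| ≤ ∑ j, |f j| :=
        Finset.single_le_sum (f := fun j => |f j|) (fun j _ => abs_nonneg _) (Finset.mem_univ _)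
      calc |Z n m ω| * |f (η (grid t n m) ω)| ≤ 1 * |f (η (grid t n m) ω)| :=
            mul_le_mul_of_nonneg_right (hZb n m ω) (abs_nonneg _)
        _ ≤ _ := by rw [one_mul]; exact h1
  -- `G n m` interpolates between `h t i` (`m = 0`) and the discretized expectation (`m = n`).
  let G : ℕ → ℕ → ℝ := fun n m =>
    ∫ ω, Z n m ω * h ((t - grid t n m : ℝ≥0) : ℝ) (η (grid t n m) ω) ∂(P i)
  have hG0 : ∀ n, G n 0 = h t i := by
    intro n
    have hstart : ∀ᵐ ω ∂(P i), η 0 ω = i :=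
      (mem_ae_iff_prob_eq_one ((hη.stronglyMeasurable 0).measurable
        (measurableSet_singleton i))).2 (hη.start i)
    have : ∀ᵐ ω ∂(P i), Z n 0 ω * h ((t - grid t n 0 : ℝ≥0) : ℝ) (η (grid t n 0) ω) = h t i := by
      filter_upwards [hstart] with ω hω
      simp [Z, gridWeight, grid_zero, hω]
    simp only [G]
    rw [integral_congr_ae this]
    simp
  have hGn : ∀ n ≠ 0, G n n = ∫ ω, Z n n ω ∂(P i) := by
    intro n hn
    simp only [G, grid_self t hn, tsub_self, NNReal.coe_zero, hinit, mul_one]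
  have hstep : ∀ n m, G n (m + 1) = ∫ ω, Z n m ω * ∑ k,
      NormedSpace.exp (((t / n : ℝ≥0) : ℝ) • L) (η (grid t n m) ω) k *
        (a (t - grid t n m) (η (grid t n m) ω) k *
          Real.exp (-(((t / n : ℝ≥0) : ℝ) * κ (t - grid t n m) (η (grid t n m) ω))) *
            h ((t - grid t n (m + 1) : ℝ≥0) : ℝ) k) ∂(P i) := by
    intro n m
    rw [← hη.integral_transition hL i (grid t n m) (t / n) (hZF n m) (hZb n m)
      (fun j k => a (t - grid t n m) j k *
          Real.exp (-(((t / n : ℝ≥0) : ℝ) * κ (t - grid t n m) j)) *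
            h ((t - grid t n (m + 1) : ℝ≥0) : ℝ) k)]
    refine integral_congr_ae (Eventually.of_forall fun ω => ?_)
    simp only [Z, gridWeight, Finset.prod_range_succ, ← grid_succ]
    ring
  rw [Metric.tendsto_nhds]
  intro ε hε
  have hε' : 0 < ε / (t + 1) := div_pos hε (by positivity)
  have hδ : Tendsto (fun n : ℕ => ((t / n : ℝ≥0) : ℝ)) atTop (𝓝[≥] 0) :=
    tendsto_nhdsWithin_iff.2 ⟨NNReal.tendsto_coe.2 (tendsto_div_nat t),
      Eventually.of_forall fun n => NNReal.coe_nonneg _⟩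
  filter_upwards [hδ.eventually (eventually_one_step_error_le L ha ha1 hκ hh hderiv t hε'),
    eventually_ne_atTop 0] with n hn hn0
  have hdist : ∀ {m}, m < n → dist (G n m) (G n (m + 1)) ≤ ε / (t + 1) * ((t / n : ℝ≥0) : ℝ) := by
    intro m hm
    have hle : grid t n (m + 1) ≤ t :=
      (grid_mono t n (Nat.succ_le_of_lt hm)).trans (grid_self t hn0).le
    have hr : ((t - grid t n (m + 1) : ℝ≥0) : ℝ)
        = ((t - grid t n m : ℝ≥0) : ℝ) - ((t / n : ℝ≥0) : ℝ) := by
      rw [NNReal.coe_sub hle, NNReal.coe_sub ((grid_mono t n m.le_succ).trans hle), grid_succ]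
      push_cast
      ring
    have hmem : ((t - grid t n m : ℝ≥0) : ℝ) ∈ Set.Icc ((t / n : ℝ≥0) : ℝ) t := by
      refine ⟨?_, NNReal.coe_le_coe.2 tsub_le_self⟩
      have := NNReal.coe_nonneg (t - grid t n (m + 1))
      rw [hr] at this
      linarith
    have hn' := hn _ hmem
    simp only [Real.toNNReal_coe] at hn'
    rw [dist_comm, Real.dist_eq, hstep, ← integral_sub (hint n m fun j => ∑ k,
      NormedSpace.exp (((t / n : ℝ≥0) : ℝ) • L) j k *
        (a (t - grid t n m) j k *
          Real.exp (-(((t / n : ℝ≥0) : ℝ) * κ (t - grid t n m) j)) *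
            h ((t - grid t n (m + 1) : ℝ≥0) : ℝ) k)) (hint n m _)]
    have hb := norm_integral_le_of_norm_le_const (μ := P i)
      (f := fun ω => Z n m ω * (∑ k,
        NormedSpace.exp (((t / n : ℝ≥0) : ℝ) • L) (η (grid t n m) ω) k *
          (a (t - grid t n m) (η (grid t n m) ω) k *
            Real.exp (-(((t / n : ℝ≥0) : ℝ) * κ (t - grid t n m) (η (grid t n m) ω))) *
              h ((t - grid t n (m + 1) : ℝ≥0) : ℝ) k))
        - Z n m ω * h ((t - grid t n m : ℝ≥0) : ℝ) (η (grid t n m) ω))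
      (C := ε / (t + 1) * ((t / n : ℝ≥0) : ℝ)) (Eventually.of_forall fun ω => by
        rw [← mul_sub, norm_mul, hr]
        calc _ ≤ 1 * (ε / (t + 1) * ((t / n : ℝ≥0) : ℝ)) :=
              mul_le_mul (hZb n m ω) (hn' _) (abs_nonneg _) zero_le_one
          _ = _ := one_mul _)
    simpa using! hb
  have htel := dist_le_range_sum_of_dist_le n (f := G n) hdist
  rw [hG0, hGn n hn0, Finset.sum_const, Finset.card_range, nsmul_eq_mul, dist_comm] at htel
  refine htel.trans_lt ?_
  have hn0' : (n : ℝ) ≠ 0 := by exact_mod_cast hn0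
  have hcancel : (n : ℝ) * (ε / (t + 1) * ((t / n : ℝ≥0) : ℝ)) = ε * (t / (t + 1)) := by
    push_cast
    field_simp
  rw [hcancel]
  have hlt : (t : ℝ) / (t + 1) < 1 := (div_lt_one (by positivity)).2 (by linarith)
  nlinarith

end FeynmanKac

/-! ### Differentiability of the branching mechanism -/

section Elementary

/-- Chain rule along a sequence of difference quotients. -/
theorem tendsto_differenceQuotient {f : ℝ → ℝ} {f' a w : ℝ} (hf : HasDerivAt f f' a)
    {u ε : ℕ → ℝ} (hε : Tendsto ε atTop (𝓝 0)) (hε0 : ∀ n, ε n ≠ 0)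
    (hu : Tendsto (fun n => (u n - a) / ε n) atTop (𝓝 w)) :
    Tendsto (fun n => (f (u n) - f a) / ε n) atTop (𝓝 (f' * w)) := by
  have hd : Tendsto (fun n => u n - a) atTop (𝓝 0) := by
    have := hε.mul hu
    rw [zero_mul] at this
    exact this.congr fun n => mul_div_cancel₀ _ (hε0 n)
  have h := hf.hasFDerivAt.hasFDerivWithinAt (s := Set.univ).lim (c := fun n => (ε n)⁻¹) hd
    (Eventually.of_forall fun _ => Set.mem_univ _)
    (hu.congr fun n => by rw [smul_eq_mul, div_eq_inv_mul])
  have h' : Tendsto (fun n => (f (u n) - f a) / ε n) atTop (𝓝 (w * f')) := by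
    refine Tendsto.congr (fun n => ?_)
      (by simpa only [ContinuousLinearMap.toSpanSingleton_apply, smul_eq_mul] using h)
    rw [div_eq_inv_mul, show a + (u n - a) = u n by ring]
  rwa [mul_comm] at h'

theorem exp_neg_sub_exp_neg_le {x y : ℝ} (hx : 0 ≤ x) (hxy : x ≤ y) :
    Real.exp (-x) - Real.exp (-y) ≤ y - x := by
  have h1 : Real.exp (-y) = Real.exp (-x) * Real.exp (-(y - x)) := by
    rw [← Real.exp_add]; ring_nf
  have h2 := mul_le_mul_of_nonneg_left (Real.add_one_le_exp (-(y - x))) (Real.exp_pos (-x)).le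
  have h3 := mul_le_mul_of_nonneg_left (Real.exp_le_one_iff.2 (neg_nonpos.2 hx))
    (sub_nonneg.2 hxy)
  linarith

theorem abs_exp_neg_sub_add_le {x y : ℝ} (hx : 0 ≤ x) (hy : 0 ≤ y) :
    |Real.exp (-y) - Real.exp (-x) + (y - x)|
      ≤ |y - x| * ((1 - Real.exp (-x)) ⊔ (1 - Real.exp (-y))) := by
  wlog hxy : x ≤ y generalizing x y
  · have h := this hy hx (le_of_not_ge hxy)
    rw [sup_comm, abs_sub_comm y x]
    rwa [← abs_neg, show -(Real.exp (-y) - Real.exp (-x) + (y - x))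
      = Real.exp (-x) - Real.exp (-y) + (x - y) by ring]
  have h1 : Real.exp (-x) = Real.exp (-y) * Real.exp (y - x) := by
    rw [← Real.exp_add]; ring_nf
  have h2 := mul_le_mul_of_nonneg_left (Real.add_one_le_exp (y - x)) (Real.exp_pos (-y)).le
  have h3 := exp_neg_sub_exp_neg_le hx hxy
  have hs : 0 ≤ y - x := sub_nonneg.2 hxy
  have h4 := mul_le_mul_of_nonneg_left
    (le_sup_right (a := 1 - Real.exp (-x)) (b := 1 - Real.exp (-y))) hs
  rw [abs_of_nonneg hs, abs_of_nonneg (by linarith)]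
  linarith

end Elementary

section Pairing

variable {d : ℕ}

theorem pairing_nonneg (u z : Fin d → ℝ≥0) : 0 ≤ pairing u z :=
  Finset.sum_nonneg fun _ _ => by positivity

theorem continuous_pairing_left (z : Fin d → ℝ≥0) : Continuous fun u => pairing u z := by
  unfold pairing; fun_prop

theorem continuous_pairing_right (u : Fin d → ℝ≥0) : Continuous fun z => pairing u z := by
  unfold pairing; fun_prop

theorem euclNorm_nonneg (z : Fin d → ℝ≥0) : 0 ≤ euclNorm z := Real.sqrt_nonneg _

theorem coe_le_euclNorm (z : Fin d → ℝ≥0) (j : Fin d) : (z j : ℝ) ≤ euclNorm z :=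
  Real.le_sqrt_of_sq_le
    (Finset.single_le_sum (f := fun j => (z j : ℝ) ^ 2) (fun _ _ => sq_nonneg _)
      (Finset.mem_univ j))

theorem pairing_le {u : Fin d → ℝ≥0} {K : ℝ≥0} (hu : ∀ j, u j ≤ K) (z : Fin d → ℝ≥0) :
    pairing u z ≤ K * d * euclNorm z := by
  have : pairing u z ≤ ∑ _j : Fin d, (K : ℝ) * euclNorm z :=
    Finset.sum_le_sum fun j _ => mul_le_mul (NNReal.coe_le_coe.2 (hu j)) (coe_le_euclNorm z j)
      (NNReal.coe_nonneg _) (NNReal.coe_nonneg _)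
  refine this.trans_eq ?_
  simp
  ring

theorem exp_neg_pairing_le_one (u z : Fin d → ℝ≥0) : Real.exp (-pairing u z) ≤ 1 :=
  Real.exp_le_one_iff.2 (neg_nonpos.2 (pairing_nonneg u z))

theorem mul_one_sub_exp_le {u : Fin d → ℝ≥0} {K : ℝ≥0} (hu : ∀ j, u j ≤ K) (z : Fin d → ℝ≥0)
    (j : Fin d) : (z j : ℝ) * (1 - Real.exp (-pairing u z))
      ≤ (1 + K * d) * min (euclNorm z) (euclNorm z ^ 2) := by
  have hn := euclNorm_nonneg z
  have h1 : 1 - Real.exp (-pairing u z) ≤ 1 := by linarith [Real.exp_pos (-pairing u z)]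
  have h2 : 1 - Real.exp (-pairing u z) ≤ K * d * euclNorm z := by
    linarith [Real.add_one_le_exp (-pairing u z), pairing_le hu z]
  have h0 : 0 ≤ 1 - Real.exp (-pairing u z) := sub_nonneg.2 (exp_neg_pairing_le_one u z)
  have hKd : (0 : ℝ) ≤ K * d := by positivity
  have hz := coe_le_euclNorm z j
  have h3 : (z j : ℝ) * (1 - Real.exp (-pairing u z))
      ≤ euclNorm z * (1 - Real.exp (-pairing u z)) := mul_le_mul_of_nonneg_right hz h0
  rcases min_cases (euclNorm z) (euclNorm z ^ 2) with ⟨h, _⟩ | ⟨h, _⟩ <;> rw [h]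
  · nlinarith
  · nlinarith [sq_nonneg (euclNorm z)]

end Pairing

namespace BranchingMechanism

variable {d : ℕ} (b : BranchingMechanism d)

/-- The function `‖z‖ ∧ ‖z‖² + ∑_{j ≠ i} z_j`, which is `μ_i`-integrable and dominates all
integrands below. -/
noncomputable def majorant (i : Fin d) (z : Fin d → ℝ≥0) : ℝ :=
  min (euclNorm z) (euclNorm z ^ 2) + ∑ j ∈ Finset.univ.erase i, (z j : ℝ)

theorem integrable_majorant (i : Fin d) : Integrable (majorant i) (b.μ i) := b.μ_integrable i

theorem min_euclNorm_nonneg (z : Fin d → ℝ≥0) : 0 ≤ min (euclNorm z) (euclNorm z ^ 2) :=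
  le_min (euclNorm_nonneg z) (sq_nonneg _)

theorem min_le_majorant (i : Fin d) (z : Fin d → ℝ≥0) :
    min (euclNorm z) (euclNorm z ^ 2) ≤ majorant i z :=
  le_add_of_nonneg_right (Finset.sum_nonneg fun _ _ => NNReal.coe_nonneg _)

theorem majorant_nonneg (i : Fin d) (z : Fin d → ℝ≥0) : 0 ≤ majorant i z :=
  (min_euclNorm_nonneg z).trans (min_le_majorant i z)

theorem max_sub_one_le_min (i : Fin d) (z : Fin d → ℝ≥0) :
    max ((z i : ℝ) - 1) 0 ≤ min (euclNorm z) (euclNorm z ^ 2) := by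
  have h := coe_le_euclNorm z i
  refine max_le (le_min (by linarith) ?_) (min_euclNorm_nonneg z)
  nlinarith [sq_nonneg (euclNorm z - 1), euclNorm_nonneg z]

theorem coe_le_majorant {i j : Fin d} (hij : j ≠ i) (z : Fin d → ℝ≥0) :
    (z j : ℝ) ≤ majorant i z :=
  (Finset.single_le_sum (f := fun j => (z j : ℝ)) (fun _ _ => NNReal.coe_nonneg _)
    (Finset.mem_erase.2 ⟨hij, Finset.mem_univ j⟩)).trans
    (le_add_of_nonneg_left (min_euclNorm_nonneg z))

theorem integrable_max_sub (i j : Fin d) :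
    Integrable (fun z => max ((z j : ℝ) - (if j = i then 1 else 0)) 0) (b.μ i) := by
  refine (b.integrable_majorant i).mono'
    (Continuous.aestronglyMeasurable (by fun_prop)) (Eventually.of_forall fun z => ?_)
  rw [Real.norm_of_nonneg (le_max_right _ _)]
  split_ifs with hij
  · rw [hij]
    exact (max_sub_one_le_min i z).trans (min_le_majorant i z)
  · rw [sub_zero, max_eq_left (NNReal.coe_nonneg _)]
    exact coe_le_majorant hij z

/-- The integral `∫ z_j (1 - e^{-⟨u, z⟩}) μ_i(dz)`. Together with `-B_{ji}` and the diffusion term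
it makes up the partial derivative of `ψ_i` in direction `j`. -/
noncomputable def jumpLoss (i j : Fin d) (u : Fin d → ℝ≥0) : ℝ :=
  ∫ z, (z j : ℝ) * (1 - Real.exp (-pairing u z)) ∂(b.μ i)

theorem continuous_jumpLoss_integrand (j : Fin d) (u : Fin d → ℝ≥0) :
    Continuous fun z : Fin d → ℝ≥0 => (z j : ℝ) * (1 - Real.exp (-pairing u z)) := by
  have := continuous_pairing_right u
  fun_prop

theorem jumpLoss_integrand_nonneg (j : Fin d) (u z : Fin d → ℝ≥0) :
    0 ≤ (z j : ℝ) * (1 - Real.exp (-pairing u z)) :=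
  mul_nonneg (NNReal.coe_nonneg _) (sub_nonneg.2 (exp_neg_pairing_le_one u z))

theorem jumpLoss_integrand_le {u : Fin d → ℝ≥0} {K : ℝ≥0} (hu : ∀ j, u j ≤ K) (i j : Fin d)
    (z : Fin d → ℝ≥0) :
    ‖(z j : ℝ) * (1 - Real.exp (-pairing u z))‖ ≤ (1 + K * d) * majorant i z := by
  rw [Real.norm_of_nonneg (jumpLoss_integrand_nonneg j u z)]
  refine (mul_one_sub_exp_le hu z j).trans ?_
  exact mul_le_mul_of_nonneg_left (min_le_majorant i z) (by positivity)

theorem integrable_jumpLoss (i j : Fin d) (u : Fin d → ℝ≥0) :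
    Integrable (fun z => (z j : ℝ) * (1 - Real.exp (-pairing u z))) (b.μ i) :=
  ((b.integrable_majorant i).const_mul _).mono'
    (continuous_jumpLoss_integrand j u).aestronglyMeasurable
    (Eventually.of_forall
      (jumpLoss_integrand_le (fun j => Finset.le_sup (f := u) (Finset.mem_univ j)) i j))

theorem jumpLoss_nonneg (i j : Fin d) (u : Fin d → ℝ≥0) : 0 ≤ b.jumpLoss i j u :=
  integral_nonneg fun z => jumpLoss_integrand_nonneg j u z

theorem B_nonneg {i j : Fin d} (hij : j ≠ i) : 0 ≤ b.B j i :=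
  add_nonneg (b.Btilde_nonneg j i hij) (integral_nonneg fun _ => le_max_right _ _)

theorem jumpLoss_le_B {i j : Fin d} (hij : j ≠ i) (u : Fin d → ℝ≥0) :
    b.jumpLoss i j u ≤ b.B j i := by
  have h : b.jumpLoss i j u ≤ ∫ z, max ((z j : ℝ) - (if j = i then 1 else 0)) 0 ∂(b.μ i) := by
    refine integral_mono (b.integrable_jumpLoss i j u) (b.integrable_max_sub i j) fun z => ?_
    simp only [hij, if_false, sub_zero]
    rw [max_eq_left (NNReal.coe_nonneg _)]
    refine mul_le_of_le_one_right (NNReal.coe_nonneg _) ?_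
    linarith [Real.exp_pos (-pairing u z)]
  exact h.trans (le_add_of_nonneg_left (b.Btilde_nonneg j i hij))

theorem continuous_jumpLoss (i j : Fin d) : Continuous (b.jumpLoss i j) := by
  refine continuous_iff_continuousAt.2 fun u => ?_
  set K : ℝ≥0 := Finset.univ.sup u + 1 with hK
  refine continuousAt_of_dominated (bound := fun z => (1 + K * d) * majorant i z)
    (Eventually.of_forall fun u' => (continuous_jumpLoss_integrand j u').aestronglyMeasurable) ?_
    ((b.integrable_majorant i).const_mul _) (Eventually.of_forall fun z => ?_)
  · have hnear : ∀ᶠ u' : Fin d → ℝ≥0 in 𝓝 u, ∀ k, u' k ≤ K := by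
      refine eventually_all.2 fun k => ?_
      have hlt : u k < K := lt_of_le_of_lt (Finset.le_sup (f := u) (Finset.mem_univ k))
        (lt_add_one _)
      exact ((continuous_apply k).continuousAt.eventually_lt continuousAt_const hlt).mono
        fun _ h => h.le
    filter_upwards [hnear] with u' hu'
    exact Eventually.of_forall (jumpLoss_integrand_le hu' i j)
  · have := continuous_pairing_left z
    fun_prop

/-- The integrand `e^{-⟨u, z⟩} - 1 + u_i (z_i ∧ 1)` of `ψ_i(u)`. -/
noncomputable def psiIntegrand (i : Fin d) (u z : Fin d → ℝ≥0) : ℝ :=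
  Real.exp (-pairing u z) - 1 + (u i : ℝ) * min (z i : ℝ) 1

theorem continuous_psiIntegrand (i : Fin d) (u : Fin d → ℝ≥0) :
    Continuous (psiIntegrand i u) := by
  have := continuous_pairing_right u
  unfold psiIntegrand
  fun_prop

/-- The integrand of `ψ_i` is Lipschitz in `u` on bounded sets, with a `μ_i`-integrable constant. -/
theorem abs_psiIntegrand_sub_le {u u' : Fin d → ℝ≥0} {K : ℝ≥0} (hu : ∀ j, u j ≤ K)
    (hu' : ∀ j, u' j ≤ K) {ρ : ℝ} (hρ : ∀ j, |(u' j : ℝ) - u j| ≤ ρ) (i : Fin d)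
    (z : Fin d → ℝ≥0) :
    |psiIntegrand i u' z - psiIntegrand i u z|
      ≤ ρ * (d * (1 + K * d) + 1) * majorant i z := by
  have hρ0 : 0 ≤ ρ := (abs_nonneg _).trans (hρ i)
  have hdiff : pairing u' z - pairing u z = ∑ j, ((u' j : ℝ) - u j) * z j := by
    simp only [pairing, ← Finset.sum_sub_distrib, sub_mul]
  have hS : |pairing u' z - pairing u z| ≤ ρ * ∑ j, (z j : ℝ) := by
    rw [hdiff, Finset.mul_sum]
    refine (Finset.abs_sum_le_sum_abs _ _).trans (Finset.sum_le_sum fun j _ => ?_)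
    rw [abs_mul, abs_of_nonneg (NNReal.coe_nonneg (z j))]
    exact mul_le_mul_of_nonneg_right (hρ j) (NNReal.coe_nonneg _)
  have hsum : ∀ u'' : Fin d → ℝ≥0, (∀ j, u'' j ≤ K) →
      (∑ j, (z j : ℝ)) * (1 - Real.exp (-pairing u'' z)) ≤ d * (1 + K * d) * majorant i z := by
    intro u'' hu''
    rw [Finset.sum_mul]
    refine (Finset.sum_le_sum fun j _ =>
      (le_abs_self _).trans (jumpLoss_integrand_le hu'' i j z)).trans_eq ?_
    simp
    ring
  have h1 : |Real.exp (-pairing u' z) - Real.exp (-pairing u z) + (pairing u' z - pairing u z)|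
      ≤ ρ * (d * (1 + K * d) * majorant i z) := by
    refine (abs_exp_neg_sub_add_le (pairing_nonneg u z) (pairing_nonneg u' z)).trans ?_
    have hmax : 0 ≤ (1 - Real.exp (-pairing u z)) ⊔ (1 - Real.exp (-pairing u' z)) :=
      le_sup_of_le_left (sub_nonneg.2 (exp_neg_pairing_le_one u z))
    refine (mul_le_mul_of_nonneg_right hS hmax).trans ?_
    rw [mul_assoc]
    refine mul_le_mul_of_nonneg_left ?_ hρ0
    rcases le_total (1 - Real.exp (-pairing u z)) (1 - Real.exp (-pairing u' z)) with h | h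
    · rw [sup_eq_right.2 h]; exact hsum u' hu'
    · rw [sup_eq_left.2 h]; exact hsum u hu
  have h2 : |(pairing u' z - pairing u z) - ((u' i : ℝ) - u i) * min (z i : ℝ) 1|
      ≤ ρ * majorant i z := by
    have : (pairing u' z - pairing u z) - ((u' i : ℝ) - u i) * min (z i : ℝ) 1
        = ((u' i : ℝ) - u i) * max ((z i : ℝ) - 1) 0
          + ∑ j ∈ Finset.univ.erase i, ((u' j : ℝ) - u j) * z j := by
      rw [hdiff, ← Finset.add_sum_erase _ _ (Finset.mem_univ i)]
      have : max ((z i : ℝ) - 1) 0 = z i - min (z i : ℝ) 1 := by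
        rcases le_total (z i : ℝ) 1 with h | h
        · rw [min_eq_left h, max_eq_right (by linarith)]; ring
        · rw [min_eq_right h, max_eq_left (by linarith)]
      rw [this]
      ring
    rw [this, majorant, mul_add, Finset.mul_sum]
    refine (abs_add_le _ _).trans (add_le_add ?_ ?_)
    · rw [abs_mul, abs_of_nonneg (le_max_right ((z i : ℝ) - 1) 0)]
      exact mul_le_mul (hρ i) (max_sub_one_le_min i z) (le_max_right _ _) hρ0
    · refine (Finset.abs_sum_le_sum_abs _ _).trans (Finset.sum_le_sum fun j _ => ?_)
      rw [abs_mul, abs_of_nonneg (NNReal.coe_nonneg (z j))]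
      exact mul_le_mul_of_nonneg_right (hρ j) (NNReal.coe_nonneg _)
  have hsplit : psiIntegrand i u' z - psiIntegrand i u z
      = (Real.exp (-pairing u' z) - Real.exp (-pairing u z) + (pairing u' z - pairing u z))
        - ((pairing u' z - pairing u z) - ((u' i : ℝ) - u i) * min (z i : ℝ) 1) := by
    simp only [psiIntegrand]; ring
  rw [hsplit]
  refine (abs_sub _ _).trans ((add_le_add h1 h2).trans_eq ?_)
  ring

theorem integrable_psiIntegrand (i : Fin d) (u : Fin d → ℝ≥0) :
    Integrable (psiIntegrand i u) (b.μ i) := by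
  set K : ℝ≥0 := Finset.univ.sup u
  have hK : ∀ j, u j ≤ K := fun j => Finset.le_sup (f := u) (Finset.mem_univ j)
  refine ((b.integrable_majorant i).const_mul (K * (d * (1 + K * d) + 1))).mono'
    (continuous_psiIntegrand i u).aestronglyMeasurable (Eventually.of_forall fun z => ?_)
  have h := abs_psiIntegrand_sub_le (u := 0) (u' := u) (K := K) (ρ := K) (fun _ => zero_le) hK
    (fun j => by simpa using hK j) i z
  simpa [psiIntegrand, pairing] using h

theorem psi_sub_psi (i : Fin d) (u u' : Fin d → ℝ≥0) :
    b.psi i u' - b.psi i u = -(∑ j, ((u' j : ℝ) - u j) * b.Btilde j i)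
      + b.c i * (((u' i : ℝ) + u i) * ((u' i : ℝ) - u i))
      + ∫ z, (psiIntegrand i u' z - psiIntegrand i u z) ∂(b.μ i) := by
  rw [integral_sub (b.integrable_psiIntegrand i u') (b.integrable_psiIntegrand i u)]
  simp only [psi, psiIntegrand, sub_mul, Finset.sum_sub_distrib]
  ring

theorem exists_lipschitz_psi (K : ℝ≥0) : ∃ Λ : ℝ≥0, ∀ (i : Fin d) (u u' : Fin d → ℝ≥0) (ρ : ℝ),
    (∀ j, u j ≤ K) → (∀ j, u' j ≤ K) → (∀ j, |(u' j : ℝ) - u j| ≤ ρ) →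
      |b.psi i u' - b.psi i u| ≤ Λ * ρ := by
  have h : ∀ i, ∃ Λ : ℝ≥0, ∀ (u u' : Fin d → ℝ≥0) (ρ : ℝ),
      (∀ j, u j ≤ K) → (∀ j, u' j ≤ K) → (∀ j, |(u' j : ℝ) - u j| ≤ ρ) →
        |b.psi i u' - b.psi i u| ≤ Λ * ρ := by
    intro i
    set I : ℝ := ∫ z, majorant i z ∂(b.μ i) with hI
    have hI0 : 0 ≤ I := integral_nonneg fun z => majorant_nonneg i z
    refine ⟨⟨(∑ j, |b.Btilde j i|) + b.c i * (K + K) + (d * (1 + K * d) + 1) * I, by positivity⟩,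
      fun u u' ρ hu hu' hρ => ?_⟩
    have hρ0 : 0 ≤ ρ := (abs_nonneg _).trans (hρ i)
    rw [psi_sub_psi]
    change _ ≤ ((∑ j, |b.Btilde j i|) + b.c i * (K + K) + (d * (1 + K * d) + 1) * I) * ρ
    have h1 : |-(∑ j, ((u' j : ℝ) - u j) * b.Btilde j i)| ≤ (∑ j, |b.Btilde j i|) * ρ := by
      rw [abs_neg, Finset.sum_mul]
      refine (Finset.abs_sum_le_sum_abs _ _).trans (Finset.sum_le_sum fun j _ => ?_)
      rw [abs_mul, mul_comm]
      exact mul_le_mul_of_nonneg_left (hρ j) (abs_nonneg _)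
    have h2 : |b.c i * (((u' i : ℝ) + u i) * ((u' i : ℝ) - u i))| ≤ b.c i * (K + K) * ρ := by
      rw [abs_mul, abs_mul, abs_of_nonneg (NNReal.coe_nonneg _), mul_assoc]
      refine mul_le_mul_of_nonneg_left ?_ (NNReal.coe_nonneg _)
      refine mul_le_mul ?_ (hρ i) (abs_nonneg _) (by positivity)
      rw [abs_of_nonneg (by positivity)]
      exact add_le_add (NNReal.coe_le_coe.2 (hu' i)) (NNReal.coe_le_coe.2 (hu i))
    have h3 : |∫ z, (psiIntegrand i u' z - psiIntegrand i u z) ∂(b.μ i)|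
        ≤ (d * (1 + K * d) + 1) * I * ρ := by
      have := norm_integral_le_of_norm_le
        (f := fun z => psiIntegrand i u' z - psiIntegrand i u z)
        ((b.integrable_majorant i).const_mul (ρ * (d * (1 + K * d) + 1)))
        (Eventually.of_forall (abs_psiIntegrand_sub_le hu hu' hρ i))
      rw [integral_const_mul] at this
      refine this.trans_eq ?_
      rw [hI]
      ring
    calc _ ≤ |-(∑ j, ((u' j : ℝ) - u j) * b.Btilde j i)|
          + |b.c i * (((u' i : ℝ) + u i) * ((u' i : ℝ) - u i))|
          + |∫ z, (psiIntegrand i u' z - psiIntegrand i u z) ∂(b.μ i)| := abs_add_three _ _ _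
      _ ≤ _ := by linarith
  choose Λ hΛ using h
  refine ⟨Finset.univ.sup Λ, fun i u u' ρ hu hu' hρ => (hΛ i u u' ρ hu hu' hρ).trans ?_⟩
  have : (Λ i : ℝ) ≤ (Finset.univ.sup Λ : ℝ≥0) :=
    NNReal.coe_le_coe.2 (Finset.le_sup (f := Λ) (Finset.mem_univ i))
  exact mul_le_mul_of_nonneg_right this ((abs_nonneg _).trans (hρ i))

/-- `ψ_i` has a one-sided directional derivative on the closed orthant. -/
theorem tendsto_psi_differenceQuotient (i : Fin d) {u : Fin d → ℝ≥0} {U : ℕ → Fin d → ℝ≥0}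
    {K : ℝ≥0} (hu : ∀ j, u j ≤ K) (hU : ∀ n j, U n j ≤ K) {ε : ℕ → ℝ} (hε0 : ∀ n, 0 < ε n)
    (hε : Tendsto ε atTop (𝓝 0)) {C : ℝ} (hC : ∀ n j, |(U n j : ℝ) - u j| ≤ C * ε n)
    {w : Fin d → ℝ} (hw : ∀ j, Tendsto (fun n => ((U n j : ℝ) - u j) / ε n) atTop (𝓝 (w j))) :
    Tendsto (fun n => (b.psi i (U n) - b.psi i u) / ε n) atTop
      (𝓝 (-(∑ j, b.B j i * w j) + 2 * b.c i * u i * w i + ∑ j, b.jumpLoss i j u * w j)) := by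
  have hne : ∀ n, ε n ≠ 0 := fun n => (hε0 n).ne'
  have hpair : ∀ z : Fin d → ℝ≥0, Tendsto (fun n => (pairing (U n) z - pairing u z) / ε n) atTop
      (𝓝 (∑ j, w j * z j)) := by
    intro z
    refine (tendsto_finsetSum Finset.univ fun j _ => (hw j).mul_const (z j : ℝ)).congr fun n => ?_
    simp only [pairing, ← Finset.sum_sub_distrib, Finset.sum_div]
    exact Finset.sum_congr rfl fun j _ => by ring
  have hint : Tendsto (fun n => ∫ z, (psiIntegrand i (U n) z - psiIntegrand i u z) / ε n ∂(b.μ i))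
      atTop (𝓝 (∫ z, (∑ j, w j * ((z j : ℝ) * (1 - Real.exp (-pairing u z)))
        - ∑ j, w j * max ((z j : ℝ) - (if j = i then 1 else 0)) 0) ∂(b.μ i))) := by
    refine tendsto_integral_of_dominated_convergence
      (fun z => C * (d * (1 + K * d) + 1) * majorant i z) (fun n => ?_)
      ((b.integrable_majorant i).const_mul _) (fun n => Eventually.of_forall fun z => ?_)
      (Eventually.of_forall fun z => ?_)
    · exact (((continuous_psiIntegrand i (U n)).sub
        (continuous_psiIntegrand i u)).div_const _).aestronglyMeasurable
    · rw [norm_div, Real.norm_of_nonneg (hε0 n).le, div_le_iff₀ (hε0 n)]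
      refine (abs_psiIntegrand_sub_le hu (hU n) (hC n) i z).trans_eq ?_
      ring
    · have hexp : HasDerivAt (fun x : ℝ => Real.exp (-x)) (-Real.exp (-pairing u z))
          (pairing u z) := by
        simpa using! (hasDerivAt_neg (pairing u z)).exp
      have h1 := tendsto_differenceQuotient hexp hε hne (hpair z)
      have h2 := h1.add ((hw i).mul_const (min (z i : ℝ) 1))
      have hlim : -Real.exp (-pairing u z) * ∑ j, w j * (z j : ℝ) + w i * min (z i : ℝ) 1
          = ∑ j, w j * ((z j : ℝ) * (1 - Real.exp (-pairing u z)))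
            - ∑ j, w j * max ((z j : ℝ) - (if j = i then 1 else 0)) 0 := by
        have hj : ∀ j, w j * max ((z j : ℝ) - (if j = i then 1 else 0)) 0
            = w j * z j - if j = i then w i * min (z i : ℝ) 1 else 0 := by
          intro j
          split_ifs with hji
          · rw [hji]
            rcases le_total (z i : ℝ) 1 with h | h
            · rw [min_eq_left h, max_eq_right (by linarith)]; ring
            · rw [min_eq_right h, max_eq_left (by linarith)]; ring
          · rw [sub_zero, sub_zero, max_eq_left (NNReal.coe_nonneg _)]
        simp only [hj, Finset.sum_sub_distrib, Finset.sum_ite_eq', Finset.mem_univ, if_true,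
          Finset.mul_sum, mul_sub, mul_one]
        rw [sub_sub_sub_cancel_left, sub_eq_neg_add, ← Finset.sum_neg_distrib]
        congr 1
        exact Finset.sum_congr rfl fun j _ => by ring
      rw [← hlim]
      refine h2.congr fun n => ?_
      simp only [psiIntegrand]
      ring
  have hB : ∀ j, b.B j i = b.Btilde j i +
      ∫ z, max ((z j : ℝ) - (if j = i then 1 else 0)) 0 ∂(b.μ i) := fun j => rfl
  have hval : ∫ z, (∑ j, w j * ((z j : ℝ) * (1 - Real.exp (-pairing u z)))
        - ∑ j, w j * max ((z j : ℝ) - (if j = i then 1 else 0)) 0) ∂(b.μ i)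
      = ∑ j, b.jumpLoss i j u * w j - ∑ j, (b.B j i - b.Btilde j i) * w j := by
    rw [integral_sub
      (integrable_finsetSum _ fun j _ => (b.integrable_jumpLoss i j u).const_mul _)
      (integrable_finsetSum _ fun j _ => (b.integrable_max_sub i j).const_mul _),
      integral_finsetSum _ fun j _ => (b.integrable_jumpLoss i j u).const_mul _,
      integral_finsetSum _ fun j _ => (b.integrable_max_sub i j).const_mul _]
    simp only [integral_const_mul, hB, add_sub_cancel_left]
    simp only [mul_comm (w _), jumpLoss]
  rw [hval] at hint
  have hUi : Tendsto (fun n => (U n i : ℝ) + u i) atTop (𝓝 (u i + u i)) := by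
    refine Tendsto.add_const _ ?_
    have := (hε.mul (hw i)).add_const (u i : ℝ)
    rw [zero_mul, zero_add] at this
    exact this.congr fun n => by rw [mul_div_cancel₀ _ (hne n), sub_add_cancel]
  have hlin := (tendsto_finsetSum Finset.univ fun j _ => (hw j).mul_const (b.Btilde j i)).neg
  have hquad := (hUi.mul (hw i)).const_mul (b.c i : ℝ)
  have hlim := (hlin.add hquad).add hint
  have hrhs : -(∑ j, b.B j i * w j) + 2 * b.c i * u i * w i + ∑ j, b.jumpLoss i j u * w j
      = -(∑ j, w j * b.Btilde j i) + b.c i * (((u i : ℝ) + u i) * w i)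
        + (∑ j, b.jumpLoss i j u * w j - ∑ j, (b.B j i - b.Btilde j i) * w j) := by
    simp only [sub_mul, Finset.sum_sub_distrib, mul_comm (w _)]
    ring
  rw [hrhs]
  refine hlim.congr fun n => ?_
  rw [psi_sub_psi, add_div, add_div, integral_div, neg_div, Finset.sum_div]
  congr 2
  · congr 1
    exact Finset.sum_congr rfl fun j _ => by ring
  · ring

end BranchingMechanism

/-! ### The cumulant semigroup as a flow -/

namespace BranchingMechanism

variable {d : ℕ} {b : BranchingMechanism d}

theorem continuous_psi (b : BranchingMechanism d) (i : Fin d) : Continuous (b.psi i) := by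
  refine continuous_iff_continuousAt.2 fun u => ?_
  set K : ℝ≥0 := Finset.univ.sup u + 1
  have hlt : ∀ k, u k < K := fun k =>
    lt_of_le_of_lt (Finset.le_sup (f := u) (Finset.mem_univ k)) (lt_add_one _)
  have hnear : ∀ᶠ u' : Fin d → ℝ≥0 in 𝓝 u, ∀ k, u' k ≤ K := eventually_all.2 fun k =>
    ((continuous_apply k).continuousAt.eventually_lt continuousAt_const (hlt k)).mono
      fun _ h => h.le
  obtain ⟨Λ, hΛ⟩ := b.exists_lipschitz_psi K
  rw [ContinuousAt, tendsto_iff_dist_tendsto_zero]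
  have h0 : Tendsto (fun u' : Fin d → ℝ≥0 => (Λ : ℝ) * dist u' u) (𝓝 u) (𝓝 0) := by
    have := (continuous_id.dist (continuous_const (y := u))).const_mul (Λ : ℝ) |>.tendsto u
    simpa using this
  refine squeeze_zero' (Eventually.of_forall fun _ => dist_nonneg) ?_ h0
  filter_upwards [hnear] with u' hu'
  exact hΛ i u u' (dist u' u) (fun k => (hlt k).le) hu' fun k => dist_le_pi_dist u' u k

namespace IsCumulant

variable {v : ℝ≥0 → (Fin d → ℝ≥0) → (Fin d → ℝ≥0)}

theorem intervalIntegrable_real (hv : b.IsCumulant v) (f : Fin d → ℝ≥0) (i : Fin d) (x y : ℝ) :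
    IntervalIntegrable (fun s : ℝ => b.psi i (v s.toNNReal f)) volume x y := by
  have h : ∀ x : ℝ, IntervalIntegrable (fun s : ℝ => b.psi i (v s.toNNReal f)) volume 0 x := by
    intro x
    rcases le_total 0 x with hx | hx
    · exact hv.intervalIntegrable f i ⟨x, hx⟩
    · refine (intervalIntegrable_const (c := b.psi i (v 0 f))).congr ?_
      intro s hs
      rw [Set.uIoc_of_ge hx] at hs
      simp only [Real.toNNReal_of_nonpos hs.2]
  exact (h x).symm.trans (h y)

theorem coe_eq (hv : b.IsCumulant v) (f : Fin d → ℝ≥0) (i : Fin d) {x : ℝ} (hx : 0 ≤ x) :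
    (v x.toNNReal f i : ℝ) = f i - ∫ s in (0 : ℝ)..x, b.psi i (v s.toNNReal f) := by
  have := hv.equation f i x.toNNReal
  rwa [Real.coe_toNNReal x hx] at this

theorem continuous_real (hv : b.IsCumulant v) (f : Fin d → ℝ≥0) :
    Continuous fun s : ℝ => v s.toNNReal f := by
  refine continuous_pi fun i => NNReal.isEmbedding_coe.continuous_iff.2 ?_
  have h : Continuous fun x : ℝ => (f i : ℝ) -
      ∫ s in (0 : ℝ)..max x 0, b.psi i (v s.toNNReal f) :=
    continuous_const.sub ((intervalIntegral.continuous_primitive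
      (hv.intervalIntegrable_real f i) 0).comp (continuous_id.max continuous_const))
  refine h.congr fun x => ?_
  rw [← hv.coe_eq f i (le_max_right x 0)]
  rcases le_total x 0 with hx | hx
  · simp [max_eq_right hx, Real.toNNReal_of_nonpos hx]
  · simp [max_eq_left hx]

theorem continuous_psi_comp (hv : b.IsCumulant v) (f : Fin d → ℝ≥0) (i : Fin d) :
    Continuous fun s : ℝ => b.psi i (v s.toNNReal f) :=
  (b.continuous_psi i).comp (hv.continuous_real f)

theorem continuous (hv : b.IsCumulant v) (f : Fin d → ℝ≥0) : Continuous fun s => v s f := by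
  refine ((hv.continuous_real f).comp NNReal.continuous_coe).congr fun s => ?_
  simp

/-- Grönwall's inequality: on bounded sets the flow is Lipschitz in the initial value. -/
theorem abs_sub_le (hv : b.IsCumulant v) {K Λ T : ℝ≥0} {f g : Fin d → ℝ≥0} {ρ : ℝ}
    (hΛ : ∀ (i : Fin d) (u u' : Fin d → ℝ≥0) (ρ : ℝ), (∀ j, u j ≤ K) → (∀ j, u' j ≤ K) →
      (∀ j, |(u' j : ℝ) - u j| ≤ ρ) → |b.psi i u' - b.psi i u| ≤ Λ * ρ)
    (hf : ∀ s ≤ T, ∀ i, v s f i ≤ K) (hg : ∀ s ≤ T, ∀ i, v s g i ≤ K)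
    (hρ0 : 0 ≤ ρ) (hρ : ∀ j, |(g j : ℝ) - f j| ≤ ρ) {s : ℝ≥0} (hs : s ≤ T) (i : Fin d) :
    |(v s g i : ℝ) - v s f i| ≤ ρ * Real.exp (Λ * T) := by
  let F : ℝ → Fin d → ℝ := fun x i => (g i - f i : ℝ) -
    ∫ s in (0 : ℝ)..x, (b.psi i (v s.toNNReal g) - b.psi i (v s.toNNReal f))
  have hF : ∀ x, 0 ≤ x → ∀ i, F x i = (v x.toNNReal g i : ℝ) - v x.toNNReal f i := by
    intro x hx i
    simp only [F]
    rw [intervalIntegral.integral_sub (hv.intervalIntegrable_real g i 0 x)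
      (hv.intervalIntegrable_real f i 0 x), hv.coe_eq g i hx, hv.coe_eq f i hx]
    ring
  have hd : ∀ x, HasDerivAt F
      (fun i => -(b.psi i (v x.toNNReal g) - b.psi i (v x.toNNReal f))) x := by
    intro x
    refine hasDerivAt_pi.2 fun i => ?_
    exact (intervalIntegral.integral_hasDerivAt_right
      ((hv.intervalIntegrable_real g i 0 x).sub (hv.intervalIntegrable_real f i 0 x))
      ((hv.continuous_psi_comp g i).sub
        (hv.continuous_psi_comp f i)).stronglyMeasurable.stronglyMeasurableAtFilter
      ((hv.continuous_psi_comp g i).sub (hv.continuous_psi_comp f i)).continuousAt).const_sub _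
  have hgron := norm_le_gronwallBound_of_norm_deriv_right_le (f := F) (δ := ρ) (K := Λ) (ε := 0)
    (a := 0) (b := T) (fun x _ => (hd x).continuousAt.continuousWithinAt)
    (fun x _ => (hd x).hasDerivWithinAt) ?_ ?_ s ⟨s.2, NNReal.coe_le_coe.2 hs⟩
  · rw [gronwallBound_ε0, sub_zero] at hgron
    have h1 := (norm_le_pi_norm (F s) i).trans hgron
    rw [hF s s.2, Real.toNNReal_coe] at h1
    refine h1.trans (mul_le_mul_of_nonneg_left (Real.exp_le_exp.2 ?_) hρ0)
    exact mul_le_mul_of_nonneg_left (NNReal.coe_le_coe.2 hs) (NNReal.coe_nonneg _)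
  · refine (pi_norm_le_iff_of_nonneg hρ0).2 fun i => ?_
    simpa [F] using hρ i
  · intro x hx
    have hxT : x.toNNReal ≤ T := Real.toNNReal_le_iff_le_coe.2 hx.2.le
    refine (pi_norm_le_iff_of_nonneg (by positivity)).2 fun i => ?_
    rw [add_zero, norm_neg]
    refine hΛ i _ _ _ (hf _ hxT) (hg _ hxT) fun j => ?_
    rw [← hF x hx.1]
    exact norm_le_pi_norm (F x) j

end IsCumulant

end BranchingMechanism

/-! ### Differentiating the Laplace functional -/

section Laplace

/-- Differentiation of `ε ↦ E[g e^{-ε Y}]` at `0`, where integrability of `g Y` is not assumed but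
follows by Fatou's lemma from a bound on the difference quotients. -/
theorem integrable_mul_and_tendsto {Ω : Type*} [MeasurableSpace Ω] {μ : Measure Ω}
    [IsProbabilityMeasure μ] {g Y : Ω → ℝ} (hg : Measurable g) (hY : Measurable Y)
    (hg0 : ∀ ω, 0 ≤ g ω) (hg1 : ∀ ω, g ω ≤ 1) (hY0 : ∀ ω, 0 ≤ Y ω) {ε : ℕ → ℝ}
    (hε0 : ∀ n, 0 < ε n) (hε : Tendsto ε atTop (𝓝 0)) {C : ℝ}
    (hC : ∀ n, ∫ ω, g ω * ((1 - Real.exp (-(ε n * Y ω))) / ε n) ∂μ ≤ C) :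
    Integrable (fun ω => g ω * Y ω) μ ∧
      Tendsto (fun n => ∫ ω, g ω * ((1 - Real.exp (-(ε n * Y ω))) / ε n) ∂μ) atTop
        (𝓝 (∫ ω, g ω * Y ω ∂μ)) := by
  let q : ℕ → Ω → ℝ := fun n ω => g ω * ((1 - Real.exp (-(ε n * Y ω))) / ε n)
  have hqm : ∀ n, Measurable (q n) := fun n => by fun_prop
  have hexp1 : ∀ n ω, Real.exp (-(ε n * Y ω)) ≤ 1 := fun n ω =>
    Real.exp_le_one_iff.2 (neg_nonpos.2 (mul_nonneg (hε0 n).le (hY0 ω)))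
  have hq0 : ∀ n ω, 0 ≤ q n ω := fun n ω =>
    mul_nonneg (hg0 ω) (div_nonneg (sub_nonneg.2 (hexp1 n ω)) (hε0 n).le)
  have hqle : ∀ n ω, q n ω ≤ g ω * Y ω := fun n ω => by
    refine mul_le_mul_of_nonneg_left ?_ (hg0 ω)
    rw [div_le_iff₀ (hε0 n)]
    linarith [Real.add_one_le_exp (-(ε n * Y ω)), mul_comm (ε n) (Y ω)]
  have hqint : ∀ n, Integrable (q n) μ := fun n => by
    refine Integrable.of_bound (C := 1 / ε n) (hqm n).aestronglyMeasurable
      (Eventually.of_forall fun ω => ?_)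
    rw [Real.norm_of_nonneg (hq0 n ω)]
    calc q n ω ≤ 1 * (1 / ε n) := by
          refine mul_le_mul (hg1 ω) ?_ (div_nonneg (sub_nonneg.2 (hexp1 n ω)) (hε0 n).le)
            zero_le_one
          exact div_le_div_of_nonneg_right (by linarith [Real.exp_pos (-(ε n * Y ω))]) (hε0 n).le
      _ = 1 / ε n := one_mul _
  have hqlim : ∀ ω, Tendsto (fun n => q n ω) atTop (𝓝 (g ω * Y ω)) := by
    intro ω
    have hd : HasDerivAt (fun x : ℝ => -Real.exp (-x)) 1 0 := by
      simpa using! (hasDerivAt_neg (0 : ℝ)).exp.neg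
    have h := tendsto_differenceQuotient (u := fun n => ε n * Y ω) (w := Y ω) hd hε
      (fun n => (hε0 n).ne') (by
        refine tendsto_const_nhds.congr fun n => ?_
        rw [sub_zero, mul_div_cancel_left₀ _ (hε0 n).ne'])
    rw [one_mul] at h
    refine (h.const_mul (g ω)).congr fun n => ?_
    simp only [q, neg_zero, Real.exp_zero]
    ring
  have hint : Integrable (fun ω => g ω * Y ω) μ := by
    refine ⟨(hg.mul hY).aestronglyMeasurable, ?_⟩
    rw [hasFiniteIntegral_iff_ofReal (Eventually.of_forall fun ω => mul_nonneg (hg0 ω) (hY0 ω))]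
    have hfatou := lintegral_liminf_le (μ := μ) (u := (atTop : Filter ℕ))
      (f := fun n ω => ENNReal.ofReal (q n ω))
      fun n => (hqm n).ennreal_ofReal
    have hlim : ∀ ω, liminf (fun n => ENNReal.ofReal (q n ω)) atTop
        = ENNReal.ofReal (g ω * Y ω) := fun ω =>
      ((ENNReal.continuous_ofReal.tendsto _).comp (hqlim ω)).liminf_eq
    simp only [hlim] at hfatou
    refine lt_of_le_of_lt (hfatou.trans ?_) (ENNReal.ofReal_lt_top (r := C))
    refine liminf_le_of_frequently_le' (Frequently.of_forall fun n => ?_)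
    rw [← ofReal_integral_eq_lintegral_ofReal (hqint n) (Eventually.of_forall (hq0 n))]
    exact ENNReal.ofReal_le_ofReal (hC n)
  refine ⟨hint, tendsto_integral_of_dominated_convergence _
    (fun n => (hqm n).aestronglyMeasurable) hint (fun n => Eventually.of_forall fun ω => ?_)
    (Eventually.of_forall hqlim)⟩
  rw [Real.norm_of_nonneg (hq0 n ω)]
  exact hqle n ω

end Laplace

/-! ### The derivative of the cumulant in its initial value -/

section BranchingProcess

variable {d : ℕ} {b : BranchingMechanism d} {v : ℝ≥0 → (Fin d → ℝ≥0) → (Fin d → ℝ≥0)}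
  {Ω : Type*} [MeasurableSpace Ω] {P : (Fin d → ℝ≥0) → Measure Ω}
  {X : ℝ≥0 → Ω → (Fin d → ℝ≥0)}

theorem pairing_single (u : Fin d → ℝ≥0) (i : Fin d) : pairing (Pi.single i 1) u = u i := by
  rw [pairing, Finset.sum_eq_single i]
  · simp
  · intro j _ hj
    simp [Pi.single_eq_of_ne hj]
  · simp

theorem pairing_add_smul (f φ z : Fin d → ℝ≥0) (ε : ℝ≥0) :
    pairing (f + ε • φ) z = pairing f z + ε * pairing φ z := by
  simp only [pairing, Finset.mul_sum, ← Finset.sum_add_distrib]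
  refine Finset.sum_congr rfl fun j _ => ?_
  simp
  ring

/-- The steps `1 / (n + 1)` along which difference quotients are taken. -/
noncomputable def step (n : ℕ) : ℝ≥0 := 1 / (n + 1)

theorem step_pos (n : ℕ) : (0 : ℝ) < step n := by
  have : (0 : ℝ≥0) < step n := by unfold step; positivity
  exact_mod_cast this

theorem step_le_one (n : ℕ) : step n ≤ 1 := by
  unfold step
  rw [div_le_one (by positivity)]
  exact le_add_self

theorem tendsto_step : Tendsto (fun n => (step n : ℝ)) atTop (𝓝 0) := by
  simpa [step] using tendsto_one_div_add_atTop_nhds_zero_nat (𝕜 := ℝ)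

theorem IsMCSBP.measurable_pairing (hX : IsMCSBP b v P X) (f : Fin d → ℝ≥0) (t : ℝ≥0) :
    Measurable fun ω => pairing f (X t ω) :=
  (continuous_pairing_right f).measurable.comp (hX.stronglyMeasurable t).measurable

theorem IsMCSBP.integrable_exp (hX : IsMCSBP b v P X) (x f : Fin d → ℝ≥0) (t : ℝ≥0) :
    Integrable (fun ω => Real.exp (-pairing f (X t ω))) (P x) := by
  have := hX.isProbabilityMeasure x
  refine Integrable.of_bound (C := 1)
    (hX.measurable_pairing f t).neg.exp.aestronglyMeasurable (Eventually.of_forall fun ω => ?_)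
  rw [Real.norm_of_nonneg (Real.exp_pos _).le]
  exact exp_neg_pairing_le_one _ _

theorem IsMCSBP.cumulant_mono (hX : IsMCSBP b v P X) {f g : Fin d → ℝ≥0} (hfg : f ≤ g) (t : ℝ≥0)
    (i : Fin d) : v t f i ≤ v t g i := by
  have h : ∫ ω, Real.exp (-pairing g (X t ω)) ∂(P (Pi.single i 1))
      ≤ ∫ ω, Real.exp (-pairing f (X t ω)) ∂(P (Pi.single i 1)) := by
    refine integral_mono (hX.integrable_exp _ _ _) (hX.integrable_exp _ _ _) fun ω => ?_
    refine Real.exp_le_exp.2 (neg_le_neg (Finset.sum_le_sum fun j _ => ?_))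
    exact mul_le_mul_of_nonneg_right (NNReal.coe_le_coe.2 (hfg j)) (NNReal.coe_nonneg _)
  rw [hX.laplace, hX.laplace, pairing_single, pairing_single, Real.exp_le_exp, neg_le_neg_iff] at h
  exact NNReal.coe_le_coe.1 h

variable (f φ : Fin d → ℝ≥0)

/-- On `[0, T]` the cumulants started from `f + step n • φ` are bounded, and their distance to the
cumulant started from `f` is of order `step n`. -/
theorem IsMCSBP.exists_cumulant_bound (hX : IsMCSBP b v P X) (T : ℝ≥0) :
    ∃ K : ℝ≥0, ∃ C : ℝ, ∀ s ≤ T, (∀ i, v s f i ≤ K) ∧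
      (∀ n i, v s (f + step n • φ) i ≤ K) ∧
      ∀ n i, |(v s (f + step n • φ) i : ℝ) - v s f i| ≤ C * step n := by
  obtain ⟨K, hK⟩ := hX.isCumulant.locally_bounded (f + φ) T
  obtain ⟨Λ, hΛ⟩ := b.exists_lipschitz_psi K
  have hle : ∀ n, f + step n • φ ≤ f + φ := fun n => by
    refine add_le_add_right (fun j => ?_) f
    simpa using mul_le_mul_of_nonneg_right (step_le_one n) (zero_le (a := φ j))
  have hf : ∀ s ≤ T, ∀ i, v s f i ≤ K := fun s hs i =>
    (hX.cumulant_mono le_self_add s i).trans (hK s hs i)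
  have hg : ∀ n, ∀ s ≤ T, ∀ i, v s (f + step n • φ) i ≤ K := fun n s hs i =>
    (hX.cumulant_mono (hle n) s i).trans (hK s hs i)
  set M : ℝ≥0 := Finset.univ.sup φ with hM
  refine ⟨K, M * Real.exp (Λ * T), fun s hs =>
    ⟨hf s hs, fun n => hg n s hs, fun n i => ?_⟩⟩
  refine (hX.isCumulant.abs_sub_le hΛ hf (hg n) (ρ := M * step n) (by positivity)
    (fun j => ?_) hs i).trans_eq (by ring)
  have h1 : ((f + step n • φ) j : ℝ) - f j = step n * φ j := by simp
  rw [h1, abs_of_nonneg (by positivity), mul_comm]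
  exact mul_le_mul_of_nonneg_right
    (NNReal.coe_le_coe.2 (Finset.le_sup (f := φ) (Finset.mem_univ j))) (NNReal.coe_nonneg _)

theorem IsMCSBP.integral_quotient (hX : IsMCSBP b v P X) (x : Fin d → ℝ≥0) (t : ℝ≥0) (n : ℕ) :
    ∫ ω, Real.exp (-pairing f (X t ω)) *
        ((1 - Real.exp (-(step n * pairing φ (X t ω)))) / step n) ∂(P x)
      = -((Real.exp (-pairing x (v t (f + step n • φ))) - Real.exp (-pairing x (v t f)))
          / step n) := by
  rw [← hX.laplace, ← hX.laplace, ← integral_sub (hX.integrable_exp _ _ _)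
    (hX.integrable_exp _ _ _), ← integral_div, ← integral_neg]
  refine integral_congr_ae (Eventually.of_forall fun ω => ?_)
  simp only [pairing_add_smul, neg_add, Real.exp_add]
  ring

/-- The tilted first moment `E_x[e^{-⟨f, X_t⟩} ⟨φ, X_t⟩]` is, up to its sign, the one-sided
derivative of the Laplace functional in direction `φ`. -/
theorem IsMCSBP.tendsto_laplace_quotient (hX : IsMCSBP b v P X) (x : Fin d → ℝ≥0) (t : ℝ≥0) :
    Tendsto (fun n => (Real.exp (-pairing x (v t (f + step n • φ))) - Real.exp (-pairing x (v t f)))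
        / step n) atTop
      (𝓝 (-∫ ω, Real.exp (-pairing f (X t ω)) * pairing φ (X t ω) ∂(P x))) := by
  have := hX.isProbabilityMeasure x
  obtain ⟨K, C, hC⟩ := hX.exists_cumulant_bound f φ t
  have h := (integrable_mul_and_tendsto (μ := P x) (g := fun ω => Real.exp (-pairing f (X t ω)))
    (Y := fun ω => pairing φ (X t ω)) (ε := fun n => step n) (C := (∑ j, (x j : ℝ)) * C)
    (hX.measurable_pairing f t).neg.exp (hX.measurable_pairing φ t)
    (fun ω => (Real.exp_pos _).le) (fun ω => exp_neg_pairing_le_one _ _)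
    (fun ω => pairing_nonneg _ _) step_pos tendsto_step fun n => ?_).2
  · simp only [hX.integral_quotient] at h
    simpa using h.neg
  · rw [hX.integral_quotient, ← neg_div, div_le_iff₀ (step_pos n)]
    have h1 : pairing x (v t (f + step n • φ)) - pairing x (v t f)
        ≤ (∑ j, (x j : ℝ)) * C * step n := by
      rw [pairing, pairing, ← Finset.sum_sub_distrib, mul_assoc, Finset.sum_mul]
      refine Finset.sum_le_sum fun j _ => ?_
      rw [← mul_sub]
      exact mul_le_mul_of_nonneg_left ((le_abs_self _).trans ((hC t le_rfl).2.2 n j))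
        (NNReal.coe_nonneg _)
    refine le_trans ?_ h1
    have hmono : pairing x (v t f) ≤ pairing x (v t (f + step n • φ)) :=
      Finset.sum_le_sum fun j _ => mul_le_mul_of_nonneg_left
        (NNReal.coe_le_coe.2 (hX.cumulant_mono le_self_add t j)) (NNReal.coe_nonneg _)
    rw [neg_sub]
    exact exp_neg_sub_exp_neg_le (pairing_nonneg _ _) hmono

/-- The derivative of `v(t, f)` in direction `φ`, written through the tilted first moment of the
process. -/
noncomputable def cumulantDeriv (v : ℝ≥0 → (Fin d → ℝ≥0) → (Fin d → ℝ≥0))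
    (P : (Fin d → ℝ≥0) → Measure Ω) (X : ℝ≥0 → Ω → (Fin d → ℝ≥0)) (f φ : Fin d → ℝ≥0) (t : ℝ≥0)
    (i : Fin d) : ℝ :=
  Real.exp (v t f i) *
    ∫ ω, Real.exp (-pairing f (X t ω)) * pairing φ (X t ω) ∂(P (Pi.single i 1))

theorem IsMCSBP.tendsto_cumulant_quotient (hX : IsMCSBP b v P X) (t : ℝ≥0) (i : Fin d) :
    Tendsto (fun n => ((v t (f + step n • φ) i : ℝ) - v t f i) / step n) atTop
      (𝓝 (cumulantDeriv v P X f φ t i)) := by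
  have h := hX.tendsto_laplace_quotient f φ (Pi.single i 1) t
  simp only [pairing_single] at h
  have hlog := tendsto_differenceQuotient (Real.hasDerivAt_log (Real.exp_pos (-(v t f i : ℝ))).ne')
    tendsto_step (fun n => (step_pos n).ne') h
  have h' := hlog.neg
  rw [← Real.exp_neg, neg_neg, mul_neg, neg_neg] at h'
  refine h'.congr fun n => ?_
  simp only [Real.log_exp]
  ring

/-- The tilted first moment is linear in the starting point up to the factor
`e^{-⟨x, v(t, f)⟩}`. -/
theorem IsMCSBP.integral_exp_mul_pairing (hX : IsMCSBP b v P X) (x : Fin d → ℝ≥0) (t : ℝ≥0) :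
    ∫ ω, Real.exp (-pairing f (X t ω)) * pairing φ (X t ω) ∂(P x)
      = Real.exp (-pairing x (v t f)) * ∑ i, (x i : ℝ) * cumulantDeriv v P X f φ t i := by
  have hpair : Tendsto
      (fun n => (pairing x (v t (f + step n • φ)) - pairing x (v t f)) / step n) atTop
      (𝓝 (∑ i, (x i : ℝ) * cumulantDeriv v P X f φ t i)) := by
    refine (tendsto_finsetSum Finset.univ fun i _ =>
      (hX.tendsto_cumulant_quotient f φ t i).const_mul (x i : ℝ)).congr fun n => ?_
    simp only [pairing, ← Finset.sum_sub_distrib, Finset.sum_div]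
    exact Finset.sum_congr rfl fun j _ => by ring
  have hexp : HasDerivAt (fun y : ℝ => Real.exp (-y)) (-Real.exp (-pairing x (v t f)))
      (pairing x (v t f)) := by
    simpa using! (hasDerivAt_neg (pairing x (v t f))).exp
  have h := tendsto_nhds_unique (hX.tendsto_laplace_quotient f φ x t)
    (tendsto_differenceQuotient hexp tendsto_step (fun n => (step_pos n).ne') hpair)
  rw [neg_mul, neg_inj] at h
  exact h

/-- The derivative of `ψ_i` at `v(s, f)` in the direction of `cumulantDeriv`. -/
noncomputable def psiDeriv (b : BranchingMechanism d)
    (v : ℝ≥0 → (Fin d → ℝ≥0) → (Fin d → ℝ≥0))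
    (P : (Fin d → ℝ≥0) → Measure Ω) (X : ℝ≥0 → Ω → (Fin d → ℝ≥0)) (f φ : Fin d → ℝ≥0) (s : ℝ≥0)
    (i : Fin d) : ℝ :=
  -(∑ j, b.B j i * cumulantDeriv v P X f φ s j)
    + 2 * b.c i * v s f i * cumulantDeriv v P X f φ s i
    + ∑ j, b.jumpLoss i j (v s f) * cumulantDeriv v P X f φ s j

theorem IsMCSBP.tendsto_psi_quotient (hX : IsMCSBP b v P X) (s : ℝ≥0) (i : Fin d) :
    Tendsto (fun n => (b.psi i (v s (f + step n • φ)) - b.psi i (v s f)) / step n) atTop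
      (𝓝 (psiDeriv b v P X f φ s i)) := by
  obtain ⟨K, C, hC⟩ := hX.exists_cumulant_bound f φ s
  obtain ⟨h1, h2, h3⟩ := hC s le_rfl
  exact b.tendsto_psi_differenceQuotient i h1 h2 step_pos tendsto_step h3
    (hX.tendsto_cumulant_quotient f φ s)

theorem IsMCSBP.exists_psi_quotient_bound (hX : IsMCSBP b v P X) (T : ℝ≥0) :
    ∃ C : ℝ, ∀ s ≤ T, ∀ n i,
      |(b.psi i (v s (f + step n • φ)) - b.psi i (v s f)) / step n| ≤ C := by
  obtain ⟨K, C, hC⟩ := hX.exists_cumulant_bound f φ T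
  obtain ⟨Λ, hΛ⟩ := b.exists_lipschitz_psi K
  refine ⟨Λ * C, fun s hs n i => ?_⟩
  obtain ⟨h1, h2, h3⟩ := hC s hs
  rw [abs_div, abs_of_pos (step_pos n), div_le_iff₀ (step_pos n), mul_assoc]
  exact hΛ i _ _ _ h1 (h2 n) (h3 n)

theorem IsMCSBP.measurable_psiDeriv (hX : IsMCSBP b v P X) (i : Fin d) :
    Measurable fun s : ℝ => psiDeriv b v P X f φ s.toNNReal i :=
  measurable_of_tendsto_metrizable (fun n =>
      (((hX.isCumulant.continuous_psi_comp (f + step n • φ) i).sub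
        (hX.isCumulant.continuous_psi_comp f i)).div_const (step n : ℝ)).measurable)
    (tendsto_pi_nhds.2 fun s => hX.tendsto_psi_quotient f φ s.toNNReal i)

theorem IsMCSBP.intervalIntegrable_psiDeriv (hX : IsMCSBP b v P X) (i : Fin d) (x y : ℝ) :
    IntervalIntegrable (fun s : ℝ => psiDeriv b v P X f φ s.toNNReal i) volume x y := by
  obtain ⟨C, hC⟩ := hX.exists_psi_quotient_bound f φ (max x y).toNNReal
  rw [intervalIntegrable_iff]
  refine Measure.integrableOn_of_bounded (M := C) (by simp)
    (hX.measurable_psiDeriv f φ i).aestronglyMeasurable ?_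
  filter_upwards [ae_restrict_mem measurableSet_uIoc] with s hs
  refine le_of_tendsto (hX.tendsto_psi_quotient f φ s.toNNReal i).norm
    (Eventually.of_forall fun n => hC _ (Real.toNNReal_le_toNNReal ?_) n i)
  exact (Set.mem_Ioc.1 hs).2

/-- The linearized cumulant equation. -/
theorem IsMCSBP.cumulantDeriv_eq (hX : IsMCSBP b v P X) (i : Fin d) {t : ℝ} (ht : 0 ≤ t) :
    cumulantDeriv v P X f φ t.toNNReal i
      = φ i - ∫ s in (0 : ℝ)..t, psiDeriv b v P X f φ s.toNNReal i := by
  obtain ⟨C, hC⟩ := hX.exists_psi_quotient_bound f φ t.toNNReal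
  have hlim := intervalIntegral.tendsto_integral_filter_of_dominated_convergence
    (μ := volume) (a := 0) (b := t) (l := atTop)
    (F := fun (n : ℕ) (s : ℝ) => (b.psi i (v s.toNNReal (f + step n • φ))
      - b.psi i (v s.toNNReal f)) / step n)
    (f := fun s => psiDeriv b v P X f φ s.toNNReal i) (fun _ => C)
    (Eventually.of_forall fun n =>
      (((hX.isCumulant.continuous_psi_comp (f + step n • φ) i).sub
        (hX.isCumulant.continuous_psi_comp f i)).div_const _).aestronglyMeasurable)
    (Eventually.of_forall fun n => Eventually.of_forall fun s hs => by
      rw [Set.uIoc_of_le ht] at hs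
      exact hC _ (Real.toNNReal_le_toNNReal hs.2) n i) (by simp)
    (Eventually.of_forall fun s _ => hX.tendsto_psi_quotient f φ s.toNNReal i)
  refine tendsto_nhds_unique (hX.tendsto_cumulant_quotient f φ t.toNNReal i)
    ((hlim.const_sub (φ i : ℝ)).congr fun n => ?_)
  rw [intervalIntegral.integral_div, intervalIntegral.integral_sub
    (hX.isCumulant.intervalIntegrable_real _ i 0 t) (hX.isCumulant.intervalIntegrable_real f i 0 t),
    hX.isCumulant.coe_eq _ i ht, hX.isCumulant.coe_eq f i ht, eq_div_iff (step_pos n).ne', sub_mul,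
    div_mul_cancel₀ _ (step_pos n).ne']
  simp
  ring

theorem IsMCSBP.continuous_cumulantDeriv (hX : IsMCSBP b v P X) (i : Fin d) :
    Continuous fun s : ℝ => cumulantDeriv v P X f φ s.toNNReal i := by
  have h : Continuous fun x : ℝ => (φ i : ℝ) -
      ∫ s in (0 : ℝ)..max x 0, psiDeriv b v P X f φ s.toNNReal i :=
    continuous_const.sub ((intervalIntegral.continuous_primitive
      (hX.intervalIntegrable_psiDeriv f φ i) 0).comp (continuous_id.max continuous_const))
  refine h.congr fun x => ?_
  rw [← hX.cumulantDeriv_eq f φ i (le_max_right x 0)]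
  rcases le_total x 0 with hx | hx
  · simp [max_eq_right hx, Real.toNNReal_of_nonpos hx]
  · simp [max_eq_left hx]

theorem IsMCSBP.continuous_psiDeriv (hX : IsMCSBP b v P X) (i : Fin d) :
    Continuous fun s : ℝ => psiDeriv b v P X f φ s.toNNReal i := by
  have h1 := hX.isCumulant.continuous_real f
  have h2 := fun j => hX.continuous_cumulantDeriv f φ j
  have h3 : ∀ j, Continuous fun s : ℝ => b.jumpLoss i j (v s.toNNReal f) := fun j =>
    (b.continuous_jumpLoss i j).comp h1
  have h4 : Continuous fun s : ℝ => (v s.toNNReal f i : ℝ) :=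
    NNReal.continuous_coe.comp ((continuous_apply i).comp h1)
  unfold psiDeriv
  exact (((continuous_finsetSum _ fun j _ => (h2 j).const_mul _).neg).add
    ((h4.const_mul _).mul (h2 i))).add (continuous_finsetSum _ fun j _ => (h3 j).mul (h2 j))

theorem IsMCSBP.hasDerivAt_cumulantDeriv (hX : IsMCSBP b v P X) (i : Fin d) {r : ℝ} (hr : 0 < r) :
    HasDerivAt (fun s : ℝ => cumulantDeriv v P X f φ s.toNNReal i)
      (-psiDeriv b v P X f φ r.toNNReal i) r := by
  have h := (intervalIntegral.integral_hasDerivAt_right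
    (hX.intervalIntegrable_psiDeriv f φ i 0 r)
    (hX.continuous_psiDeriv f φ i).stronglyMeasurable.stronglyMeasurableAtFilter
    (hX.continuous_psiDeriv f φ i).continuousAt).const_sub (φ i : ℝ)
  refine h.congr_of_eventuallyEq ?_
  filter_upwards [lt_mem_nhds hr] with s hs
  exact hX.cumulantDeriv_eq f φ i hs.le

theorem IsMCSBP.cumulantDeriv_zero (hX : IsMCSBP b v P X) (i : Fin d) :
    cumulantDeriv v P X f φ 0 i = φ i := by
  simpa using hX.cumulantDeriv_eq f φ i le_rfl

end BranchingProcess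

/-! ### The spine formula -/

namespace BranchingMechanism

variable {d : ℕ} (b : BranchingMechanism d) (v : ℝ≥0 → (Fin d → ℝ≥0) → (Fin d → ℝ≥0))
  (f : Fin d → ℝ≥0)

theorem jumpMatrix_self (s : ℝ≥0) (i : Fin d) : b.jumpMatrix v f s i i = 1 := by
  simp [jumpMatrix]

theorem jumpMatrix_of_ne (s : ℝ≥0) {i j : Fin d} (hij : j ≠ i) :
    b.jumpMatrix v f s i j = 1 - b.jumpLoss i j (v s f) / b.B j i := by
  have h : ∫ z, (z j : ℝ) * (Real.exp (-pairing (v s f) z) - 1) ∂(b.μ i)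
      = -b.jumpLoss i j (v s f) := by
    rw [jumpLoss, ← integral_neg]
    refine integral_congr_ae (Eventually.of_forall fun z => ?_)
    ring
  simp only [jumpMatrix, if_pos hij.symm, h, Matrix.transpose_apply]
  ring

theorem jumpMatrix_nonneg (s : ℝ≥0) (i j : Fin d) : 0 ≤ b.jumpMatrix v f s i j := by
  rcases eq_or_ne j i with rfl | hij
  · rw [jumpMatrix_self]; exact zero_le_one
  · rw [jumpMatrix_of_ne b v f s hij, sub_nonneg]
    exact div_le_one_of_le₀ (b.jumpLoss_le_B hij _) (b.B_nonneg hij)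

theorem jumpMatrix_le_one (s : ℝ≥0) (i j : Fin d) : b.jumpMatrix v f s i j ≤ 1 := by
  rcases eq_or_ne j i with rfl | hij
  · rw [jumpMatrix_self]
  · rw [jumpMatrix_of_ne b v f s hij]
    exact sub_le_self _ (div_nonneg (b.jumpLoss_nonneg i j _) (b.B_nonneg hij))

theorem B_mul_jumpMatrix (s : ℝ≥0) {i j : Fin d} (hij : j ≠ i) :
    b.B j i * b.jumpMatrix v f s i j = b.B j i - b.jumpLoss i j (v s f) := by
  rw [jumpMatrix_of_ne b v f s hij, mul_sub, mul_one]
  rcases eq_or_ne (b.B j i) 0 with h | h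
  · have := le_antisymm (h ▸ b.jumpLoss_le_B hij (v s f)) (b.jumpLoss_nonneg i j _)
    rw [h, this]
    simp
  · rw [mul_div_cancel₀ _ h]

variable {v} in
theorem continuous_jumpMatrix (hv : b.IsCumulant v) (i j : Fin d) :
    Continuous fun s => b.jumpMatrix v f s i j := by
  rcases eq_or_ne j i with rfl | hij
  · simp only [jumpMatrix_self]; exact continuous_const
  · simp only [jumpMatrix_of_ne b v f _ hij]
    exact continuous_const.sub (((b.continuous_jumpLoss i j).comp (hv.continuous f)).div_const _)

/-- The rate `2 c_i v_i(s, f) + ∫ z_i (1 - e^{-⟨v(s, f), z⟩}) μ_i(dz)` at which the weight of the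
spine decays while it is in state `i`. -/
noncomputable def killingRate (s : ℝ≥0) (i : Fin d) : ℝ :=
  2 * (b.c i : ℝ) * (v s f i : ℝ) + b.jumpLoss i i (v s f)

theorem spineGenerator_nonneg (lam : ℝ) (φ : Fin d → ℝ≥0) {i j : Fin d} (hij : i ≠ j) :
    0 ≤ b.spineGenerator lam φ i j := by
  simp only [spineGenerator, if_neg hij, sub_zero, Matrix.transpose_apply]
  exact mul_nonneg (mul_nonneg (by positivity) (b.B_nonneg hij.symm)) (NNReal.coe_nonneg _)

end BranchingMechanism

section Spine

variable {d : ℕ} {b : BranchingMechanism d} {v : ℝ≥0 → (Fin d → ℝ≥0) → (Fin d → ℝ≥0)}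
  {Ω : Type*} [MeasurableSpace Ω] {P : (Fin d → ℝ≥0) → Measure Ω}
  {X : ℝ≥0 → Ω → (Fin d → ℝ≥0)}

/-- The `φ`-transform of the linearized cumulant equation is the backward equation of the
Feynman–Kac functional of the spine. -/
theorem IsMCSBP.hasDerivAt_transform (hX : IsMCSBP b v P X) (lam : ℝ) {φ : Fin d → ℝ≥0}
    (hφ : ∀ i, 0 < φ i) (f : Fin d → ℝ≥0) (i : Fin d) {r : ℝ} (hr : 0 < r) :
    HasDerivAt
      (fun r : ℝ => Real.exp (-(lam * r)) * cumulantDeriv v P X f φ r.toNNReal i / φ i)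
      (∑ j, b.spineGenerator lam φ i j * b.jumpMatrix v f r.toNNReal i j *
          (Real.exp (-(lam * r)) * cumulantDeriv v P X f φ r.toNNReal j / φ j)
        - b.killingRate v f r.toNNReal i *
          (Real.exp (-(lam * r)) * cumulantDeriv v P X f φ r.toNNReal i / φ i)) r := by
  have hφ0 : ∀ j, (φ j : ℝ) ≠ 0 := fun j => by exact_mod_cast (hφ j).ne'
  have h1 : HasDerivAt (fun r : ℝ => Real.exp (-(lam * r))) (Real.exp (-(lam * r)) * -lam) r := by
    simpa using! ((hasDerivAt_id r).const_mul lam).neg.exp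
  refine ((h1.fun_mul (hX.hasDerivAt_cumulantDeriv f φ i hr)).div_const (φ i : ℝ)).congr_deriv ?_
  symm
  set s := r.toNNReal
  set e := Real.exp (-(lam * r))
  have hterm : ∀ j, b.spineGenerator lam φ i j * b.jumpMatrix v f s i j *
      (e * cumulantDeriv v P X f φ s j / φ j)
      = e / φ i * ((b.B j i - b.jumpLoss i j (v s f)) * cumulantDeriv v P X f φ s j
        + if i = j then (b.jumpLoss i i (v s f) - lam) * cumulantDeriv v P X f φ s i else 0) := by
    intro j
    rcases eq_or_ne i j with rfl | hij
    · rw [BranchingMechanism.jumpMatrix_self, BranchingMechanism.spineGenerator, if_pos rfl,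
        if_pos rfl, Matrix.transpose_apply]
      field_simp [hφ0 i]
      ring
    · rw [← b.B_mul_jumpMatrix v f s hij.symm, BranchingMechanism.spineGenerator, if_neg hij,
        if_neg hij, Matrix.transpose_apply]
      field_simp [hφ0 i, hφ0 j]
      ring
  simp only [hterm, ← Finset.mul_sum, Finset.sum_add_distrib, Finset.sum_ite_eq, Finset.mem_univ,
    if_true, sub_mul, Finset.sum_sub_distrib, psiDeriv, BranchingMechanism.killingRate]
  field_simp [hφ0 i]
  ring

/-- The spine functional has expectation `e^{-λ₁ t} w_i(t) / φ(i)` when the spine starts in `i`. -/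
theorem IsMCSBP.feynman_kac_spine (hX : IsMCSBP b v P X) (lam : ℝ) {φ : Fin d → ℝ≥0}
    (hφ : ∀ i, 0 < φ i) {Ω' : Type*} [MeasurableSpace Ω'] {Pφ : Fin d → Measure Ω'}
    {η : ℝ≥0 → Ω' → Fin d} (hη : IsMarkovChain (b.spineGenerator lam φ) Pφ η)
    (f : Fin d → ℝ≥0) (t : ℝ≥0) (i : Fin d) :
    Integrable (fun ω => feynmanKacWeight (b.jumpMatrix v f) (b.killingRate v f) t
      fun r => η r ω) (Pφ i) ∧
    ∫ ω, feynmanKacWeight (b.jumpMatrix v f) (b.killingRate v f) t (fun r => η r ω) ∂(Pφ i)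
      = Real.exp (-(lam * t)) * cumulantDeriv v P X f φ t i / φ i := by
  have h := hη.feynman_kac (fun i j hij => b.spineGenerator_nonneg lam φ hij)
    (a := b.jumpMatrix v f) (κ := b.killingRate v f)
    (h := fun r i => Real.exp (-(lam * r)) * cumulantDeriv v P X f φ r.toNNReal i / φ i)
    (b.continuous_jumpMatrix f hX.isCumulant) (b.jumpMatrix_nonneg v f)
    (b.jumpMatrix_le_one v f) (b.jumpMatrix_self v f) (fun i => ?_) (fun s i => ?_) (fun i => ?_)
    (fun i r hr => hX.hasDerivAt_transform lam hφ f i hr) (fun i => ?_) t i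
  · simpa using h
  · have hv := hX.isCumulant.continuous f
    exact ((NNReal.continuous_coe.comp ((continuous_apply i).comp hv)).const_mul _).add
      ((b.continuous_jumpLoss i i).comp hv)
  · exact add_nonneg (by positivity) (b.jumpLoss_nonneg i i _)
  · have := hX.continuous_cumulantDeriv f φ i
    fun_prop
  · have : (φ i : ℝ) ≠ 0 := by exact_mod_cast (hφ i).ne'
    simp [hX.cumulantDeriv_zero, this]

end Spine

end MCSBP

/-- The spine formula for the Laplace functional of the `h`-transformed process. The measure `Q`
is the tilted measure: its restriction to `σ(X_s, s ≤ t)` has density `W_t / ⟨φ, x⟩` with respect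
to `P_x`. The product over `s ≤ t` has only finitely many factors that are not equal to `1`. -/
theorem theorem4 {d : ℕ} (b : MCSBP.BranchingMechanism d)
    (v : ℝ≥0 → (Fin d → ℝ≥0) → (Fin d → ℝ≥0))
    {Ω : Type*} [MeasurableSpace Ω] (P : (Fin d → ℝ≥0) → Measure Ω)
    (X : ℝ≥0 → Ω → (Fin d → ℝ≥0)) (hX : MCSBP.IsMCSBP b v P X)
    (lam : ℝ) (φ : Fin d → ℝ≥0)
    (hφ : MCSBP.IsPerronPair (MCSBP.meanMatrix P X) lam φ)
    {Ω' : Type*} [MeasurableSpace Ω'] (Pφ : Fin d → Measure Ω') (η : ℝ≥0 → Ω' → Fin d)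
    (hη : MCSBP.IsMarkovChain (b.spineGenerator lam φ) Pφ η)
    (x : Fin d → ℝ≥0) (hx : x ≠ 0) (f : Fin d → ℝ≥0) (t : ℝ≥0)
    (Q : Measure Ω)
    (hQ : ∀ A : Set Ω, MeasurableSet[Filtration.natural X hX.stronglyMeasurable t] A →
      Q A = ∫⁻ ω in A, ENNReal.ofReal (MCSBP.W lam φ X t ω / MCSBP.pairing φ x) ∂(P x)) :
    ∫ ω, Real.exp (-MCSBP.pairing f (X t ω)) ∂Q
      = (∫ ω, Real.exp (-MCSBP.pairing f (X t ω)) ∂(P x)) *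
        ∫ ω, Real.exp (-∫ s in (0 : ℝ)..(t : ℝ),
              (2 * (b.c (η s.toNNReal ω) : ℝ) * (v (t - s.toNNReal) f (η s.toNNReal ω) : ℝ)
                + ∫ z, (z (η s.toNNReal ω) : ℝ) *
                    (1 - Real.exp (-MCSBP.pairing (v (t - s.toNNReal) f) z))
                  ∂(b.μ (η s.toNNReal ω))))
            * ∏ᶠ (s : ℝ≥0) (_ : s ≤ t),
                b.jumpMatrix v f (t - s) (Function.leftLim (fun r => η r ω) s) (η s ω)
          ∂(MCSBP.spineLaw Pφ φ x) := by
  have hm := (Filtration.natural X hX.stronglyMeasurable).le t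
  have hXt := Filtration.stronglyAdapted_natural hX.stronglyMeasurable t
  -- The tilted expectation, as an expectation under `P x`.
  have hgm : StronglyMeasurable[Filtration.natural X hX.stronglyMeasurable t]
      fun ω => Real.exp (-MCSBP.pairing f (X t ω)) :=
    (Real.continuous_exp.comp (MCSBP.continuous_pairing_right f).neg).comp_stronglyMeasurable hXt
  have hWm : Measurable fun ω => ENNReal.ofReal (MCSBP.W lam φ X t ω / MCSBP.pairing φ x) :=
    (((hX.measurable_pairing φ t).const_mul _).div_const _).ennreal_ofReal
  have htrim : Q.trim hm = ((P x).withDensity fun ω =>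
      ENNReal.ofReal (MCSBP.W lam φ X t ω / MCSBP.pairing φ x)).trim hm := by
    refine @Measure.ext _ (Filtration.natural X hX.stronglyMeasurable t) _ _ fun A hA => ?_
    rw [trim_measurableSet_eq hm hA, trim_measurableSet_eq hm hA, hQ A hA,
      withDensity_apply _ (hm A hA)]
  have hleft : ∫ ω, Real.exp (-MCSBP.pairing f (X t ω)) ∂Q
      = Real.exp (-(lam * t)) / MCSBP.pairing φ x *
        (Real.exp (-MCSBP.pairing x (v t f)) *
          ∑ i, (x i : ℝ) * MCSBP.cumulantDeriv v P X f φ t i) := by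
    rw [integral_trim hm hgm, htrim, ← integral_trim hm hgm,
      integral_withDensity_eq_integral_toReal_smul hWm
        (Eventually.of_forall fun _ => ENNReal.ofReal_lt_top),
      ← hX.integral_exp_mul_pairing f φ x t, ← integral_const_mul]
    refine integral_congr_ae (Eventually.of_forall fun ω => ?_)
    have h0 : 0 ≤ MCSBP.W lam φ X t ω / MCSBP.pairing φ x :=
      div_nonneg (mul_nonneg (Real.exp_pos _).le (MCSBP.pairing_nonneg _ _))
        (MCSBP.pairing_nonneg _ _)
    beta_reduce
    rw [ENNReal.toReal_ofReal h0, smul_eq_mul, MCSBP.W]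
    ring
  -- The functional of the chain, as the value of the backward equation.
  have hfk := fun i => hX.feynman_kac_spine lam hφ.pos hη f t i
  have hright : ∫ ω, MCSBP.feynmanKacWeight (b.jumpMatrix v f) (b.killingRate v f) t
      (fun r => η r ω) ∂(MCSBP.spineLaw Pφ φ x)
      = Real.exp (-(lam * t)) / MCSBP.pairing φ x *
          ∑ i, (x i : ℝ) * MCSBP.cumulantDeriv v P X f φ t i := by
    rw [MCSBP.spineLaw, integral_finsetSum_measure fun i _ =>
      (hfk i).1.smul_measure ENNReal.ofReal_ne_top, Finset.mul_sum]
    refine Finset.sum_congr rfl fun i _ => ?_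
    have h0 : 0 ≤ (φ i : ℝ) * x i / MCSBP.pairing φ x :=
      div_nonneg (by positivity) (MCSBP.pairing_nonneg _ _)
    have hφi : (φ i : ℝ) ≠ 0 := by exact_mod_cast (hφ.pos i).ne'
    rw [integral_smul_measure, (hfk i).2, ENNReal.toReal_ofReal h0, smul_eq_mul]
    field_simp
  rw [hleft, hX.laplace]
  refine Eq.trans ?_ (congrArg (Real.exp (-MCSBP.pairing x (v t f)) * ·) hright.symm)
  ring
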